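/- Let $\{x(n)\}_{n\in\mathbb Z}$ be a complex second-order random process with autocorrelation $r_x(n,m)=\mathbb E[x(n+m)x^*(n)]$ satisfying $\sum_{m\in\mathbb Z}\sup_{n}|r_x(n,m)|^2<\infty$, and with average power $P_x=\lim_{N\to\infty}\frac1N\sum_{n=-N/2}^{N/2-1}\mathbb E|x(n)|^2\in(0,\infty)$. Throughout, $N$ is even and limits of functions of $\lambda\in[0,1)$ are limits in Lebesgue measure (which covers limits almost everywhere and in $L^p$). A family $\{\theta(n,\lambda)\}_{n\in\mathbb Z,\ \lambda\in[0,1)}$ with $\theta(n,\cdot)\in L^2[0,1)$ is called a *unitary basis* if $\int_0^1\theta(n,\lambda)\theta^*(n',\lambda)\,d\lambda=\delta_{n-n'}$, if $\sum_{n}\theta(n,\lambda)\theta^*(n,\lambda')=\delta(\lambda-\lambda')$ as an identity of kernels acting on $L^2[0,1)$, and if this relation is normalized on the diagonal, $\lim_{N\to\infty}\frac1N\sum_{n=-N/2}^{N/2-1}|\theta(n,\lambda)|^2=1$. The process has *spectrum* $\mathcal S_{\mathcal X,\theta}$ in this basis if $$\mathcal S_{\mathcal X,\theta}(\lambda)=\lim_{N\to\infty}\frac1N\,\mathbb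 E\Bigl|\sum_{n=-N/2}^{N/2-1}x(n)\theta^*(n,\lambda)\Bigr|^2 .$$ The *representation entropy* is then $\mathrm h(\{\theta\})=-\int_0^1 \mathrm p_{x,\theta}(\lambda)\ln \mathrm p_{x,\theta}(\lambda)\,d\lambda$ with $\mathrm p_{x,\theta}=\mathcal S_{\mathcal X,\theta}/P_x$. A *Karhunen–Loève (KL) basis* of $x$ with KL spectrum $\mathcal S_{\mathcal X}:[0,1)\to\mathbb R$ is a unitary basis $\{\phi(n,\lambda)\}$ such that, for every $k\in\mathbb Z$, $$\sum_{l\in\mathbb Z}r_x(l,k-l)\,\phi(l,\lambda)=\mathcal S_{\mathcal X}(\lambda)\,\phi(k,\lambda),$$ the sum being the limit of its partial sums over $-N/2\le l<N/2$. Let $\{\phi(n,\lambda)\}$ be a KL basis of $x$ with KL spectrum $\mathcal S_{\mathcal X}$. Then the spectrum of $x$ in the basis $\{\phi\}$ exists and is $\mathcal S_{\mathcal X,\phi}=\mathcal S_{\mathcal X}$. For $\phi$, and for every unitary basis $\{\theta(n,\lambda)\}$ in which $x$ has a spectrum, the normalized spectrum is a probability density on $[0,1)$ whose representation entropy is a convergent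 integral. The KL basis has the minimum representation entropy: $$\mathrm h(\{\phi(n,\lambda)\})\le \mathrm h(\{\theta(n,\lambda)\})\qquad\text{for all such }\{\theta(n,\lambda)\}.$$ -/

import Mathlib

namespace SpectralEntropy

noncomputable section

open MeasureTheory Filter

/-- The spectral domain `[0, 1)` with Lebesgue measure. -/
def specMeasure : Measure ℝ := volume.restrict (Set.Ico (0 : ℝ) 1)

/-- The time window `{-N/2, …, N/2 - 1}` for the even length `N = 2 * M`. -/
def window (M : ℕ) : Finset ℤ := Finset.Ico (-(M : ℤ)) (M : ℤ)

/-- Orthonormal (unitary) bases `θ(n, s)`, `n ∈ ℤ`, `s ∈ [0, 1)`.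

* `orthonormal`: `∫₀¹ θ(n, s) θ*(n', s) ds = δ_{n - n'}`.
* `complete`: `∑ₙ θ(n, s) θ*(n, s') = δ(s - s')`, as an identity of kernels acting on `L²[0, 1)`.
* `normalized`: the same relation on the diagonal `s = s'`, where a window of length `N` resolves
  the spectral domain into cells `ds = 1 / N`, so that `δ(0) ds = 1`:
  `(1 / N) ∑_{n = -N/2}^{N/2 - 1} |θ(n, s)|² → 1`.

Limits of functions of `s` are taken in measure, which is weaker than almost everywhere
convergence and than convergence in any `Lᵖ` norm. -/
structure IsUnitaryBasis (θ : ℤ → ℝ → ℂ) : Prop where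
  memLp : ∀ n, MemLp (θ n) 2 specMeasure
  orthonormal : ∀ n n' : ℤ,
    ∫ s, θ n s * star (θ n' s) ∂specMeasure = if n = n' then 1 else 0
  complete : ∀ g : ℝ → ℂ, MemLp g 2 specMeasure →
    Tendsto (fun M : ℕ => eLpNorm
      (fun s => (∑ n ∈ window M, θ n s * ∫ s', star (θ n s') * g s' ∂specMeasure) - g s)
      2 specMeasure) atTop (nhds 0)
  normalized : TendstoInMeasure specMeasure
    (fun (M : ℕ) s => (1 / (2 * M : ℝ)) * ∑ n ∈ window M, ‖θ n s‖ ^ 2) atTop (fun _ => (1 : ℝ))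

variable {Ω : Type*} [MeasurableSpace Ω]

/-- The autocorrelation `r(n, m) = E[x(n + m) x*(n)]` at time `n` and lag `m`. -/
def autocorr (Pr : Measure Ω) (x : ℤ → Ω → ℂ) (n m : ℤ) : ℂ :=
  ∫ ω, x (n + m) ω * star (x n ω) ∂Pr

/-- The autocorrelation is square-summable in the lag, uniformly in time:
`∑ₘ supₙ |r(n, m)|² < ∞`. -/
def SquareSummableAutocorr (Pr : Measure Ω) (x : ℤ → Ω → ℂ) : Prop :=
  ∃ a : ℤ → ℝ, Summable (fun m => a m ^ 2) ∧ ∀ n m, ‖autocorr Pr x n m‖ ≤ a m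

/-- `P` is the average power `lim (1 / N) ∑_{n = -N/2}^{N/2 - 1} E|x(n)|²`. -/
def HasAveragePower (Pr : Measure Ω) (x : ℤ → Ω → ℂ) (P : ℝ) : Prop :=
  Tendsto (fun M : ℕ => (1 / (2 * M : ℝ)) * ∑ n ∈ window M, ∫ ω, ‖x n ω‖ ^ 2 ∂Pr)
    atTop (nhds P)

/-- `S` is the power spectrum of `x` in the basis `θ`, that is, `E|dη(s)|² = S(s) ds` for the
spectral increments `dη(s) = lim (1 / N) ∑_{n = -N/2}^{N/2 - 1} x(n) θ*(n, s)` with `ds = 1 / N`: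
`S(s) = lim (1 / N) E|∑_{n = -N/2}^{N/2 - 1} x(n) θ*(n, s)|²`. -/
def HasSpectrum (Pr : Measure Ω) (x : ℤ → Ω → ℂ) (θ : ℤ → ℝ → ℂ) (S : ℝ → ℝ) : Prop :=
  TendstoInMeasure specMeasure
    (fun (M : ℕ) s =>
      (1 / (2 * M : ℝ)) * ∫ ω, ‖∑ n ∈ window M, x n ω * star (θ n s)‖ ^ 2 ∂Pr) atTop S

/-- `φ` is a Karhunen–Loève basis of `x` with Karhunen–Loève spectrum `S`: it is a unitary basis
and it solves the eigenequation `∑ₗ r(l, k - l) φ(l, s) = S(s) φ(k, s)` for every `k`. -/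
structure IsKLBasis (Pr : Measure Ω) (x : ℤ → Ω → ℂ) (φ : ℤ → ℝ → ℂ) (S : ℝ → ℝ) : Prop where
  unitary : IsUnitaryBasis φ
  eigen : ∀ k : ℤ, TendstoInMeasure specMeasure
    (fun (M : ℕ) s => ∑ l ∈ window M, autocorr Pr x l (k - l) * φ l s) atTop
    (fun s => (S s : ℂ) * φ k s)

/-- The normalized spectrum `p = S / P`. -/
def normSpectrum (P : ℝ) (S : ℝ → ℝ) (s : ℝ) : ℝ := S s / P

/-- The normalized spectrum is a probability density on `[0, 1)` whose differential entropy is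
a convergent integral. -/
structure EntropyDefined (P : ℝ) (S : ℝ → ℝ) : Prop where
  nonneg : ∀ᵐ s ∂specMeasure, 0 ≤ normSpectrum P S s
  integrable : Integrable (normSpectrum P S) specMeasure
  integral_eq_one : ∫ s, normSpectrum P S s ∂specMeasure = 1
  integrable_log :
    Integrable (fun s => normSpectrum P S s * Real.log (normSpectrum P S s)) specMeasure

/-- The representation entropy `h = -∫₀¹ p(s) ln p(s) ds`. -/
def repEntropy (P : ℝ) (S : ℝ → ℝ) : ℝ :=
  -∫ s, normSpectrum P S s * Real.log (normSpectrum P S s) ∂specMeasure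

end

end SpectralEntropy

/-!
Write `S` for the Karhunen–Loève spectrum. The eigenequation says that multiplication by `S` has
the correlation matrix of `x` as its matrix in the basis `φ`. Hence the expected periodogram of `x`
in a basis `θ` is `∫ S(s') K(s, s') ds'` for `K(s, s') = (1 / N) |∑ₙ θ*(n, s) φ(n, s')|²`, a kernel
whose marginals are the diagonal averages `(1 / N) ∑ₙ |θ(n, s)|²` and `(1 / N) ∑ₙ |φ(n, s')|²`. Both
tend to `1`, so `K` is asymptotically doubly stochastic, and Jensen's inequality followed by Fatou's
lemma gives `∫ Φ(S_θ) ≤ ∫ Φ(S)` for every nonnegative convex `Φ` with `Φ(t) = o(t²)`. The growth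
condition is what allows the marginal `(1 / N) ∑ₙ |φ(n, s')|²` to be replaced by `1` in the limit,
because the square-summability of the rows bounds its integral against `S²`.

Taking `Φ(t) = t ln t + 1`, after normalization by the power, compares the entropies. Taking
`Φ(t) = (r - t)⁺` and letting `r → ∞` shows that no mass is lost: `S_θ` and `S` have the same
integral. For `θ = φ` the periodogram differs from `S(s) (1 / N) ∑ₙ |φ(n, s)|²` by the tails of the
rows outside the window, which are negligible on average.
-/

namespace SpectralEntropy

open MeasureTheory Filter Topology
open scoped Finset BigOperators

section ConvergenceInMean

variable {α : Type*} [MeasurableSpace α] {μ : Measure α}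

theorem integrable_and_integral_le_of_tendsto {u : ℕ → α → ℝ} {v : α → ℝ} {c : ℕ → ℝ} {c₀ : ℝ}
    (hu : ∀ n, Integrable (u n) μ) (hu0 : ∀ n, 0 ≤ᵐ[μ] u n) (huc : ∀ n, ∫ s, u n s ∂μ ≤ c n)
    (hc : Tendsto c atTop (𝓝 c₀)) (hv : ∀ᵐ s ∂μ, Tendsto (fun n => u n s) atTop (𝓝 (v s))) :
    Integrable v μ ∧ ∫ s, v s ∂μ ≤ c₀ := by
  have eLpNorm_eq {w : α → ℝ} (hw : Integrable w μ) (hw0 : 0 ≤ᵐ[μ] w) :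
      eLpNorm w 1 μ = ENNReal.ofReal (∫ s, w s ∂μ) := by
    rw [eLpNorm_one_eq_lintegral_enorm, ofReal_integral_eq_lintegral_ofReal hw hw0]
    exact lintegral_congr_ae <| hw0.mono fun s hs => Real.enorm_of_nonneg hs
  have hv0 : 0 ≤ᵐ[μ] v := by
    filter_upwards [hv, ae_all_iff.2 hu0] with s hs h0s using ge_of_tendsto' hs h0s
  have le_of_lt {c' : ℝ} (hc' : c₀ < c') : eLpNorm v 1 μ ≤ ENNReal.ofReal c' := by
    refine Lp.eLpNorm_le_of_ae_tendsto ?_ (fun n => (hu n).1) hv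
    filter_upwards [hc.eventually_le_const hc'] with n hn
    rw [eLpNorm_eq (hu n) (hu0 n)]
    exact ENNReal.ofReal_le_ofReal ((huc n).trans hn)
  have hvi : Integrable v μ := memLp_one_iff_integrable.1
    ⟨aestronglyMeasurable_of_tendsto_ae atTop (fun n => (hu n).1) hv,
      (le_of_lt (lt_add_one c₀)).trans_lt ENNReal.ofReal_lt_top⟩
  have hc0 : 0 ≤ c₀ := ge_of_tendsto' hc fun n => (integral_nonneg_of_ae (hu0 n)).trans (huc n)
  refine ⟨hvi, le_of_forall_gt_imp_ge_of_dense fun c' hc' => ?_⟩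
  rw [← ENNReal.ofReal_le_ofReal_iff (hc0.trans hc'.le), ← eLpNorm_eq hvi hv0]
  exact le_of_lt hc'

theorem ae_nonneg_of_tendstoInMeasure {u : ℕ → α → ℝ} {v : α → ℝ}
    (hu : ∀ n, 0 ≤ᵐ[μ] u n) (h : TendstoInMeasure μ u atTop v) : 0 ≤ᵐ[μ] v := by
  obtain ⟨ns, -, hns⟩ := h.exists_seq_tendsto_ae
  filter_upwards [hns, ae_all_iff.2 hu] with s hs h0s
  exact ge_of_tendsto' hs fun n => h0s (ns n)

theorem tendstoInMeasure_of_tendsto_integral_abs {u : ℕ → α → ℝ} {v : α → ℝ}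
    (hu : ∀ n, Integrable (u n) μ) (hv : Integrable v μ)
    (h : Tendsto (fun n => ∫ s, |u n s - v s| ∂μ) atTop (𝓝 0)) :
    TendstoInMeasure μ u atTop v := by
  refine tendstoInMeasure_of_tendsto_eLpNorm one_ne_zero (fun n => (hu n).1) hv.1 ?_
  have h' : Tendsto (fun n => ENNReal.ofReal (∫ s, ‖(u n - v) s‖ ∂μ)) atTop (𝓝 0) := by
    simpa [Function.comp_def] using (ENNReal.continuous_ofReal.tendsto 0).comp h
  refine h'.congr fun n => ?_
  rw [eLpNorm_one_eq_lintegral_enorm, ofReal_integral_norm_eq_lintegral_enorm ((hu n).sub hv)]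

theorem tendsto_integral_posPart_sub {g : ℕ → α → ℝ} {f : α → ℝ}
    (hg : ∀ n, Integrable (g n) μ) (hg0 : ∀ n, 0 ≤ᵐ[μ] g n) (hf : Integrable f μ)
    (h : TendstoInMeasure μ g atTop f) :
    Tendsto (fun n => ∫ s, max (f s - g n s) 0 ∂μ) atTop (𝓝 0) := by
  refine tendsto_of_subseq_tendsto fun ns hns => ?_
  obtain ⟨ms, -, hms⟩ := (h.comp hns).exists_seq_tendsto_ae
  refine ⟨ms, ?_⟩
  suffices Tendsto (fun n => ∫ s, max (f s - g (ns (ms n)) s) 0 ∂μ) atTop (𝓝 (∫ _, 0 ∂μ)) by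
    simpa only [integral_zero] using this
  refine tendsto_integral_of_dominated_convergence (fun s => |f s|)
    (fun n => (hf.sub (hg _)).pos_part.1) hf.abs (fun n => ?_) ?_
  · filter_upwards [hg0 (ns (ms n))] with s hs
    rw [Real.norm_of_nonneg (le_max_right _ _)]
    exact max_le (by linarith [le_abs_self (f s), show 0 ≤ g (ns (ms n)) s from hs])
      (abs_nonneg _)
  · filter_upwards [hms] with s hs
    simpa using (hs.const_sub (f s)).max (tendsto_const_nhds (x := (0 : ℝ)))

theorem tendsto_integral_abs_sub_of_tendsto_integral {g : ℕ → α → ℝ} {f : α → ℝ}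
    (hg : ∀ n, Integrable (g n) μ) (hg0 : ∀ n, 0 ≤ᵐ[μ] g n) (hf : Integrable f μ)
    (hgf : Tendsto (fun n => ∫ s, g n s ∂μ) atTop (𝓝 (∫ s, f s ∂μ)))
    (h : TendstoInMeasure μ g atTop f) :
    Tendsto (fun n => ∫ s, |g n s - f s| ∂μ) atTop (𝓝 0) := by
  have abs_eq (n : ℕ) (s : α) : |g n s - f s| = g n s - f s + 2 * max (f s - g n s) 0 := by
    rcases le_total (g n s) (f s) with hs | hs
    · rw [abs_of_nonpos (by linarith), max_eq_left (by linarith)]; ring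
    · rw [abs_of_nonneg (by linarith), max_eq_right (by linarith)]; ring
  have integral_eq (n : ℕ) : ∫ s, |g n s - f s| ∂μ =
      ∫ s, g n s ∂μ - ∫ s, f s ∂μ + 2 * ∫ s, max (f s - g n s) 0 ∂μ := by
    have hpos : Integrable (fun s => max (f s - g n s) 0) μ := (hf.sub (hg n)).pos_part
    have hsub : Integrable (fun s => g n s - f s) μ := (hg n).sub hf
    simp_rw [abs_eq]
    rw [integral_add hsub (hpos.const_mul 2), integral_sub (hg n) hf, integral_const_mul]
  simp_rw [integral_eq]
  simpa using (hgf.sub_const (∫ s, f s ∂μ)).add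
    ((tendsto_integral_posPart_sub hg hg0 hf h).const_mul 2)

end ConvergenceInMean

section Subordinate

theorem tendsto_zero_of_forall_le_mul_add {a b : ℕ → ℝ} {K : ℝ} (ha : ∀ n, 0 ≤ a n)
    (hb : Tendsto b atTop (𝓝 0)) (h : ∀ ε > 0, ∃ C, ∀ n, a n ≤ ε * K + C * b n) :
    Tendsto a atTop (𝓝 0) := by
  refine tendsto_order.2 ⟨fun δ hδ => .of_forall fun n => hδ.trans_le (ha n), fun δ hδ => ?_⟩
  obtain ⟨ε, hε, hεK⟩ := exists_pos_mul_lt hδ K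
  obtain ⟨C, hC⟩ := h ε hε
  have hlim : Tendsto (fun n => ε * K + C * b n) atTop (𝓝 (ε * K)) := by
    simpa using (hb.const_mul C).const_add (ε * K)
  filter_upwards [hlim.eventually_lt_const ((mul_comm ε K).trans_lt hεK)] with n hn
  exact (hC n).trans_lt hn

variable {α : Type*} [MeasurableSpace α] {μ : Measure α}

/-- `f` is essentially of smaller order than `q` where `q` is large: up to a bounded error, `|f|`
is at most an arbitrarily small multiple of `q`. Integrals of `f` against a sequence of densities
are then controlled uniformly by those of `q`. -/
def IsSubordinate (μ : Measure α) (f q : α → ℝ) : Prop :=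
  ∀ ε > 0, ∃ C, ∀ᵐ s ∂μ, |f s| ≤ ε * q s + C

theorem IsSubordinate.integrable_mul {f q g : α → ℝ} (h : IsSubordinate μ f q)
    (hf : AEStronglyMeasurable f μ) (hg : Integrable g μ) (hg0 : ∀ s, 0 ≤ g s)
    (hqg : Integrable (fun s => q s * g s) μ) : Integrable (fun s => f s * g s) μ := by
  obtain ⟨C, hC⟩ := h 1 one_pos
  refine (hqg.add (hg.const_mul C)).mono' (hf.mul hg.1) ?_
  filter_upwards [hC] with s hs
  calc ‖f s * g s‖ = |f s| * g s := by rw [norm_mul, Real.norm_of_nonneg (hg0 s)]; rfl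
    _ ≤ (1 * q s + C) * g s := mul_le_mul_of_nonneg_right hs (hg0 s)
    _ = q s * g s + C * g s := by ring

theorem IsSubordinate.integrable [IsFiniteMeasure μ] {f q : α → ℝ} (h : IsSubordinate μ f q)
    (hf : AEStronglyMeasurable f μ) (hq : Integrable q μ) : Integrable f μ := by
  simpa using h.integrable_mul hf (integrable_const 1) (fun _ => zero_le_one) (by simpa using hq)

theorem isSubordinate_sq (f : α → ℝ) : IsSubordinate μ f fun s => f s ^ 2 := by
  refine fun ε hε => ⟨ε⁻¹, .of_forall fun s => ?_⟩
  have hsq : 0 ≤ ε⁻¹ * ((ε * |f s| - 1) ^ 2 + ε * |f s|) := by positivity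
  have expand : ε⁻¹ * ((ε * |f s| - 1) ^ 2 + ε * |f s|) = ε * |f s| ^ 2 + ε⁻¹ - |f s| := by
    field_simp; ring
  rw [sq_abs] at expand
  exact (by linarith : |f s| ≤ ε * f s ^ 2 + ε⁻¹)

theorem isSubordinate_comp_sq {Φ : ℝ → ℝ} (hΦ : Continuous Φ) (hΦ2 : Φ =o[atTop] fun t => t ^ 2)
    {f : α → ℝ} (hf : 0 ≤ᵐ[μ] f) : IsSubordinate μ (fun s => Φ (f s)) fun s => f s ^ 2 := by
  intro ε hε
  obtain ⟨R, hR⟩ := eventually_atTop.1 (hΦ2.bound hε)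
  obtain ⟨C, hC⟩ := isCompact_Icc.exists_bound_of_continuousOn (s := Set.Icc 0 R) hΦ.continuousOn
  refine ⟨|C|, hf.mono fun s hs => ?_⟩
  rcases le_total R (f s) with hRs | hRs
  · have := hR (f s) hRs
    rw [Real.norm_eq_abs, Real.norm_of_nonneg (sq_nonneg _)] at this
    linarith [abs_nonneg C]
  · have := hC (f s) ⟨hs, hRs⟩
    rw [Real.norm_eq_abs] at this
    nlinarith [le_abs_self C, sq_nonneg (f s)]

theorem IsSubordinate.tendsto_integral_abs_mul_sub [IsFiniteMeasure μ] {g : ℕ → α → ℝ}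
    {f q : α → ℝ} {A : ℝ} (h : IsSubordinate μ f q) (hf : AEStronglyMeasurable f μ)
    (hg : ∀ n, Integrable (g n) μ) (hg0 : ∀ n s, 0 ≤ g n s)
    (hg1 : Tendsto (fun n => ∫ s, |g n s - 1| ∂μ) atTop (𝓝 0)) (hq0 : ∀ s, 0 ≤ q s)
    (hq : Integrable q μ) (hqg : ∀ n, Integrable (fun s => q s * g n s) μ)
    (hqgA : ∀ n, ∫ s, q s * g n s ∂μ ≤ A) :
    Tendsto (fun n => ∫ s, |f s * g n s - f s| ∂μ) atTop (𝓝 0) := by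
  refine tendsto_zero_of_forall_le_mul_add (K := A + ∫ s, q s ∂μ)
    (fun n => integral_nonneg fun s => abs_nonneg _) hg1 fun ε hε => ?_
  obtain ⟨C, hC⟩ := h ε hε
  refine ⟨|C|, fun n => ?_⟩
  have hfg : Integrable (fun s => f s * g n s) μ := h.integrable_mul hf (hg n) (hg0 n) (hqg n)
  have hgsub : Integrable (fun s => |g n s - 1|) μ := ((hg n).sub (integrable_const 1)).abs
  have hqsum : Integrable (fun s => q s * g n s + q s) μ := (hqg n).add hq
  calc ∫ s, |f s * g n s - f s| ∂μ
      ≤ ∫ s, (ε * (q s * g n s + q s) + |C| * |g n s - 1|) ∂μ := by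
        refine integral_mono_ae (hfg.sub (h.integrable hf hq)).abs
          ((hqsum.const_mul ε).add (hgsub.const_mul |C|)) ?_
        filter_upwards [hC] with s hs
        have hgs : |g n s - 1| ≤ g n s + 1 := by
          rw [abs_le]; constructor <;> linarith [hg0 n s]
        calc |f s * g n s - f s| = |f s| * |g n s - 1| := by rw [← abs_mul]; ring_nf
          _ ≤ (ε * q s + |C|) * |g n s - 1| := by gcongr; linarith [le_abs_self C]
          _ = ε * q s * |g n s - 1| + |C| * |g n s - 1| := by ring
          _ ≤ ε * q s * (g n s + 1) + |C| * |g n s - 1| := by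
              gcongr; exact mul_nonneg hε.le (hq0 s)
          _ = ε * (q s * g n s + q s) + |C| * |g n s - 1| := by ring
    _ = ε * (∫ s, q s * g n s ∂μ + ∫ s, q s ∂μ) + |C| * ∫ s, |g n s - 1| ∂μ := by
        rw [integral_add (hqsum.const_mul ε) (hgsub.const_mul |C|), integral_const_mul,
          integral_const_mul, integral_add (hqg n) hq]
    _ ≤ ε * (A + ∫ s, q s ∂μ) + |C| * ∫ s, |g n s - 1| ∂μ := by gcongr; exact hqgA n

end Subordinate

section Jensen

variable {α : Type*} [MeasurableSpace α] {μ : Measure α}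

theorem integral_withDensity_ofReal {w : α → ℝ} (hw : AEMeasurable w μ) (hw0 : 0 ≤ᵐ[μ] w)
    (f : α → ℝ) : ∫ s, f s ∂μ.withDensity (fun s => ENNReal.ofReal (w s)) = ∫ s, f s * w s ∂μ := by
  rw [integral_withDensity_eq_integral_toReal_smul₀ hw.ennreal_ofReal
    (.of_forall fun _ => ENNReal.ofReal_lt_top)]
  refine integral_congr_ae (hw0.mono fun s hs => ?_)
  simp only [ENNReal.toReal_ofReal hs, smul_eq_mul, mul_comm]

theorem integrable_withDensity_ofReal {w : α → ℝ} (hw : AEMeasurable w μ) (hw0 : 0 ≤ᵐ[μ] w)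
    {f : α → ℝ} (hf : Integrable (fun s => f s * w s) μ) :
    Integrable f (μ.withDensity fun s => ENNReal.ofReal (w s)) := by
  rw [integrable_withDensity_iff_integrable_smul₀' hw.ennreal_ofReal
    (.of_forall fun _ => ENNReal.ofReal_lt_top)]
  refine hf.congr (hw0.mono fun s hs => ?_)
  simp only [ENNReal.toReal_ofReal hs, smul_eq_mul, mul_comm]

theorem map_integral_div_integral_mul_integral_le {Φ : ℝ → ℝ} {D : Set ℝ} (hΦ : ConvexOn ℝ D Φ)
    (hΦc : ContinuousOn Φ D) (hD : IsClosed D) {w f : α → ℝ} (hw : Integrable w μ)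
    (hw0 : 0 ≤ᵐ[μ] w) (hf : ∀ᵐ s ∂μ, f s ∈ D) (hfw : Integrable (fun s => f s * w s) μ)
    (hΦw : Integrable (fun s => Φ (f s) * w s) μ) :
    Φ ((∫ s, f s * w s ∂μ) / ∫ s, w s ∂μ) * ∫ s, w s ∂μ ≤ ∫ s, Φ (f s) * w s ∂μ := by
  have hwm : AEMeasurable w μ := hw.1.aemeasurable
  rcases (integral_nonneg_of_ae hw0 : 0 ≤ ∫ s, w s ∂μ).eq_or_lt with hzero | hpos
  · have hw_zero : w =ᵐ[μ] 0 := (integral_eq_zero_iff_of_nonneg_ae hw0 hw).1 hzero.symm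
    rw [← hzero, mul_zero, integral_eq_zero_of_ae]
    filter_upwards [hw_zero] with s hs
    simp only [hs, Pi.zero_apply, mul_zero]
  set ν : Measure α := μ.withDensity fun s => ENNReal.ofReal (w s) with hν
  have hν_univ : ν Set.univ = ENNReal.ofReal (∫ s, w s ∂μ) := by
    rw [hν, withDensity_apply _ MeasurableSet.univ, Measure.restrict_univ,
      ofReal_integral_eq_lintegral_ofReal hw hw0]
  have hν_real : ν.real Set.univ = ∫ s, w s ∂μ := by
    rw [measureReal_def, hν_univ, ENNReal.toReal_ofReal hpos.le]
  have : IsFiniteMeasure ν := ⟨hν_univ ▸ ENNReal.ofReal_lt_top⟩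
  have : NeZero ν := ⟨fun h0 => by simp [← hν_real, h0] at hpos⟩
  have hJensen : Φ (⨍ s, f s ∂ν) ≤ ⨍ s, Φ (f s) ∂ν :=
    hΦ.map_average_le hΦc hD ((withDensity_absolutelyContinuous _ _).ae_le hf)
      (integrable_withDensity_ofReal hwm hw0 hfw) (integrable_withDensity_ofReal hwm hw0 hΦw)
  rw [average_eq, average_eq, integral_withDensity_ofReal hwm hw0,
    integral_withDensity_ofReal hwm hw0, hν_real, smul_eq_mul, smul_eq_mul, inv_mul_eq_div,
    inv_mul_eq_div] at hJensen
  exact (le_div_iff₀ hpos).1 hJensen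

end Jensen

section SecondMoments

variable {ι α : Type*} [MeasurableSpace α] {μ : Measure α}

theorem integral_norm_mul_norm_le_sqrt_mul_sqrt {E F : Type*} [NormedAddCommGroup E]
    [NormedAddCommGroup F] {f : α → E} {g : α → F} (hf : MemLp f 2 μ) (hg : MemLp g 2 μ) :
    ∫ s, ‖f s‖ * ‖g s‖ ∂μ ≤ √(∫ s, ‖f s‖ ^ 2 ∂μ) * √(∫ s, ‖g s‖ ^ 2 ∂μ) := by
  have h := integral_mul_norm_le_Lp_mul_Lq Real.HolderConjugate.two_two
    (f := fun s => ‖f s‖) (g := fun s => ‖g s‖) (by simpa using hf.norm) (by simpa using hg.norm)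
  simpa only [norm_norm, Real.rpow_two, Real.sqrt_eq_rpow] using h

theorem integrable_mul_star {f g : α → ℂ} (hf : MemLp f 2 μ) (hg : MemLp g 2 μ) :
    Integrable (fun s => f s * star (g s)) μ :=
  hf.integrable_mul hg.star

theorem ofReal_norm_sq_eq_mul_star (z : ℂ) : ((‖z‖ ^ 2 : ℝ) : ℂ) = z * star z := by
  simpa using (Complex.mul_conj' z).symm

theorem ofReal_norm_sq_sum_mul (F : Finset ι) (c z : ι → ℂ) :
    ((‖∑ k ∈ F, c k * z k‖ ^ 2 : ℝ) : ℂ) =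
      ∑ k ∈ F, ∑ l ∈ F, c k * star (c l) * (z k * star (z l)) := by
  rw [ofReal_norm_sq_eq_mul_star, star_sum, Finset.sum_mul_sum]
  simp only [star_mul', mul_mul_mul_comm]

theorem ofReal_integral_mul_norm_sq_sum {v : α → ℝ} {φ : ι → α → ℂ}
    (h : ∀ k l, Integrable (fun s => (v s : ℂ) * (φ k s * star (φ l s))) μ) (F : Finset ι)
    (c : ι → ℂ) :
    ((∫ s, v s * ‖∑ k ∈ F, c k * φ k s‖ ^ 2 ∂μ : ℝ) : ℂ) =
      ∑ k ∈ F, ∑ l ∈ F, c k * star (c l) * ∫ s, (v s : ℂ) * (φ k s * star (φ l s)) ∂μ := by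
  have expand (s : α) : ((v s * ‖∑ k ∈ F, c k * φ k s‖ ^ 2 : ℝ) : ℂ) =
      ∑ k ∈ F, ∑ l ∈ F, c k * star (c l) * ((v s : ℂ) * (φ k s * star (φ l s))) := by
    rw [Complex.ofReal_mul, ofReal_norm_sq_sum_mul]
    simp only [Finset.mul_sum, mul_left_comm]
  have hint (k l : ι) :
      Integrable (fun s => c k * star (c l) * ((v s : ℂ) * (φ k s * star (φ l s)))) μ :=
    (h k l).const_mul _
  simp_rw [← integral_complex_ofReal, expand, ← integral_const_mul]
  rw [integral_finsetSum _ fun k _ => integrable_finsetSum F fun l _ => hint k l]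
  exact Finset.sum_congr rfl fun k _ => integral_finsetSum F fun l _ => hint k l

theorem ofReal_integral_norm_sq_sum {φ : ι → α → ℂ} (hφ : ∀ n, MemLp (φ n) 2 μ) (F : Finset ι)
    (c : ι → ℂ) :
    ((∫ s, ‖∑ k ∈ F, c k * φ k s‖ ^ 2 ∂μ : ℝ) : ℂ) =
      ∑ k ∈ F, ∑ l ∈ F, c k * star (c l) * ∫ s, φ k s * star (φ l s) ∂μ := by
  simpa using ofReal_integral_mul_norm_sq_sum (v := fun _ => 1)
    (fun k l => by simpa using integrable_mul_star (hφ k) (hφ l)) F c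

end SecondMoments

section Orthonormal

variable {ι α : Type*} [DecidableEq ι] [MeasurableSpace α] {μ : Measure α} {θ : ι → α → ℂ}

/-- An orthonormal system of square-integrable functions, given by representatives so that it can
be evaluated pointwise. -/
structure IsOrthonormalSystem (μ : Measure α) (θ : ι → α → ℂ) : Prop where
  memLp : ∀ n, MemLp (θ n) 2 μ
  integral_mul_star : ∀ n n', ∫ s, θ n s * star (θ n' s) ∂μ = if n = n' then 1 else 0

namespace IsOrthonormalSystem

theorem integrable_norm_sq (hθ : IsOrthonormalSystem μ θ) (n : ι) :
    Integrable (fun s => ‖θ n s‖ ^ 2) μ :=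
  (hθ.memLp n).norm.integrable_sq

theorem memLp_sum (hθ : IsOrthonormalSystem μ θ) (F : Finset ι) (c : ι → ℂ) :
    MemLp (fun s => ∑ l ∈ F, c l * θ l s) 2 μ :=
  memLp_finsetSum F fun l _ => (hθ.memLp l).const_mul (c l)

theorem integral_norm_sq_sum (hθ : IsOrthonormalSystem μ θ) (F : Finset ι) (c : ι → ℂ) :
    ∫ s, ‖∑ l ∈ F, c l * θ l s‖ ^ 2 ∂μ = ∑ l ∈ F, ‖c l‖ ^ 2 := by
  apply Complex.ofReal_injective
  rw [ofReal_integral_norm_sq_sum hθ.memLp, Complex.ofReal_sum]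
  refine Finset.sum_congr rfl fun k hk => ?_
  simp only [hθ.integral_mul_star, mul_ite, mul_one, mul_zero, Finset.sum_ite_eq, if_pos hk,
    ofReal_norm_sq_eq_mul_star]

theorem integral_norm_sq (hθ : IsOrthonormalSystem μ θ) (n : ι) : ∫ s, ‖θ n s‖ ^ 2 ∂μ = 1 := by
  simpa using hθ.integral_norm_sq_sum {n} 1

theorem integral_sum_mul_star (hθ : IsOrthonormalSystem μ θ) {F : Finset ι} {n : ι} (hn : n ∈ F)
    (c : ι → ℂ) : ∫ s, (∑ l ∈ F, c l * θ l s) * star (θ n s) ∂μ = c n := by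
  simp_rw [Finset.sum_mul, mul_assoc]
  rw [integral_finsetSum F fun l _ =>
    (integrable_mul_star (hθ.memLp l) (hθ.memLp n)).const_mul (c l)]
  simp only [integral_const_mul, hθ.integral_mul_star, mul_ite, mul_one, mul_zero,
    Finset.sum_ite_eq', if_pos hn]

variable {W : ℕ → Finset ι} {c : ι → ℂ} {f : α → ℂ}

theorem integrable_norm_sq_sub_sum_and_integral_le (hθ : IsOrthonormalSystem μ θ)
    (hW : Tendsto W atTop atTop) (hc : Summable fun l => ‖c l‖ ^ 2)
    (hf : TendstoInMeasure μ (fun M s => ∑ l ∈ W M, c l * θ l s) atTop f) (F : Finset ι) :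
    Integrable (fun s => ‖f s - ∑ l ∈ F, c l * θ l s‖ ^ 2) μ ∧
      ∫ s, ‖f s - ∑ l ∈ F, c l * θ l s‖ ^ 2 ∂μ ≤ ∑' l : {l // l ∉ F}, ‖c l‖ ^ 2 := by
  obtain ⟨N, hN⟩ := eventually_atTop.1 (hW.eventually_ge_atTop F)
  obtain ⟨ns, -, hns⟩ := (hf.comp (tendsto_add_atTop_nat N)).exists_seq_tendsto_ae
  have hF (n : ℕ) : F ⊆ W (ns n + N) := hN _ (Nat.le_add_left N _)
  refine integrable_and_integral_le_of_tendsto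
    (u := fun n s => ‖∑ l ∈ W (ns n + N) \ F, c l * θ l s‖ ^ 2)
    (fun n => (hθ.memLp_sum _ c).norm.integrable_sq) (fun n => .of_forall fun s => by positivity)
    (fun n => ?_) tendsto_const_nhds ?_
  · rw [hθ.integral_norm_sq_sum, ← Finset.sum_subtype_of_mem (p := (· ∉ F)) (fun l => ‖c l‖ ^ 2)
      fun l hl => (Finset.mem_sdiff.1 hl).2]
    exact (hc.subtype _).sum_le_tsum _ fun l _ => by positivity
  · filter_upwards [hns] with s hs
    refine ((hs.sub_const (∑ l ∈ F, c l * θ l s)).norm.pow 2).congr fun n => ?_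
    rw [Function.comp_apply, ← Finset.sum_sdiff (hF n), add_sub_cancel_right]

theorem memLp_of_tendstoInMeasure (hθ : IsOrthonormalSystem μ θ) (hW : Tendsto W atTop atTop)
    (hc : Summable fun l => ‖c l‖ ^ 2)
    (hf : TendstoInMeasure μ (fun M s => ∑ l ∈ W M, c l * θ l s) atTop f) : MemLp f 2 μ := by
  rw [memLp_two_iff_integrable_sq_norm
    (hf.aestronglyMeasurable fun M => (hθ.memLp_sum (W M) c).1)]
  simpa using (hθ.integrable_norm_sq_sub_sum_and_integral_le hW hc hf ∅).1

theorem integral_mul_star_of_tendstoInMeasure (hθ : IsOrthonormalSystem μ θ)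
    (hW : Tendsto W atTop atTop) (hc : Summable fun l => ‖c l‖ ^ 2)
    (hf : TendstoInMeasure μ (fun M s => ∑ l ∈ W M, c l * θ l s) atTop f) (n : ι) :
    ∫ s, f s * star (θ n s) ∂μ = c n := by
  have hfL : MemLp f 2 μ := hθ.memLp_of_tendstoInMeasure hW hc hf
  have dist_le {F : Finset ι} (hn : n ∈ F) :
      ‖∫ s, f s * star (θ n s) ∂μ - c n‖ ≤ √(∑' l : {l // l ∉ F}, ‖c l‖ ^ 2) := by
    calc ‖∫ s, f s * star (θ n s) ∂μ - c n‖
        = ‖∫ s, (f s - ∑ l ∈ F, c l * θ l s) * star (θ n s) ∂μ‖ := by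
          simp_rw [sub_mul]
          rw [integral_sub (integrable_mul_star hfL (hθ.memLp n))
            (integrable_mul_star (hθ.memLp_sum F c) (hθ.memLp n)), hθ.integral_sum_mul_star hn]
      _ ≤ ∫ s, ‖f s - ∑ l ∈ F, c l * θ l s‖ * ‖θ n s‖ ∂μ := by
          simpa using norm_integral_le_integral_norm (μ := μ)
            fun s => (f s - ∑ l ∈ F, c l * θ l s) * star (θ n s)
      _ ≤ √(∫ s, ‖f s - ∑ l ∈ F, c l * θ l s‖ ^ 2 ∂μ) * √(∫ s, ‖θ n s‖ ^ 2 ∂μ) :=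
          integral_norm_mul_norm_le_sqrt_mul_sqrt (hfL.sub (hθ.memLp_sum F c)) (hθ.memLp n)
      _ ≤ √(∑' l : {l // l ∉ F}, ‖c l‖ ^ 2) := by
          rw [hθ.integral_norm_sq, Real.sqrt_one, mul_one]
          exact Real.sqrt_le_sqrt (hθ.integrable_norm_sq_sub_sum_and_integral_le hW hc hf F).2
  have htail : Tendsto (fun F : Finset ι => √(∑' l : {l // l ∉ F}, ‖c l‖ ^ 2)) atTop (𝓝 0) := by
    simpa using (tendsto_tsum_compl_atTop_zero fun l => ‖c l‖ ^ 2).sqrt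
  refine sub_eq_zero.1 (norm_le_zero_iff.1 (ge_of_tendsto htail ?_))
  filter_upwards [eventually_ge_atTop {n}] with F hF
  exact dist_le (Finset.singleton_subset_iff.1 hF)

end IsOrthonormalSystem

end Orthonormal

section Average

variable {ι α : Type*} [MeasurableSpace α] {μ : Measure α}

theorem integrable_expect {F : Finset ι} {f : ι → α → ℝ} (hf : ∀ n ∈ F, Integrable (f n) μ) :
    Integrable (fun s => 𝔼 n ∈ F, f n s) μ := by
  simp_rw [Finset.expect_eq_sum_div_card]
  exact (integrable_finsetSum F hf).div_const _

theorem integral_expect {F : Finset ι} {f : ι → α → ℝ} (hf : ∀ n ∈ F, Integrable (f n) μ) :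
    ∫ s, 𝔼 n ∈ F, f n s ∂μ = 𝔼 n ∈ F, ∫ s, f n s ∂μ := by
  simp_rw [Finset.expect_eq_sum_div_card]
  rw [integral_div, integral_finsetSum F hf]

end Average

section Kernel

variable {ι α β : Type*}

/-- The diagonal `(1 / N) ∑ₙ |θ(n, s)|²` of the resolution of the identity over the indices `F`,
where `N` is the size of `F`. -/
noncomputable def diagAverage (θ : ι → α → ℂ) (F : Finset ι) (s : α) : ℝ :=
  𝔼 n ∈ F, ‖θ n s‖ ^ 2

/-- The kernel `(1 / N) |∑ₙ θ*(n, s) φ(n, s')|²` over the indices `F`, where `N` is the size of `F`: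
the approximate transition density from `s` to `s'` under the change of basis from `θ` to `φ`. -/
noncomputable def transition (θ : ι → β → ℂ) (φ : ι → α → ℂ) (F : Finset ι) (s : β) (s' : α) : ℝ :=
  ‖∑ n ∈ F, star (θ n s) * φ n s'‖ ^ 2 / #F

theorem diagAverage_nonneg (θ : ι → β → ℂ) (F : Finset ι) (s : β) : 0 ≤ diagAverage θ F s :=
  Finset.expect_nonneg fun _ _ => by positivity

theorem transition_nonneg (θ : ι → β → ℂ) (φ : ι → α → ℂ) (F : Finset ι) (s : β) (s' : α) :
    0 ≤ transition θ φ F s s' := by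
  unfold transition; positivity

theorem transition_comm (θ : ι → β → ℂ) (φ : ι → α → ℂ) (F : Finset ι) (s : β) (s' : α) :
    transition θ φ F s s' = transition φ θ F s' s := by
  simp only [transition]
  rw [← norm_star, star_sum]
  simp only [star_mul, star_star]

theorem transition_le (θ : ι → β → ℂ) (φ : ι → α → ℂ) (F : Finset ι) (s : β) (s' : α) :
    transition θ φ F s s' ≤ (∑ n ∈ F, ‖θ n s‖ ^ 2) * diagAverage φ F s' := by
  rw [transition, diagAverage, Finset.expect_eq_sum_div_card, ← mul_div_assoc]
  gcongr
  calc ‖∑ n ∈ F, star (θ n s) * φ n s'‖ ^ 2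
      ≤ (∑ n ∈ F, ‖θ n s‖ * ‖φ n s'‖) ^ 2 := by
        gcongr
        simpa only [norm_mul, norm_star] using norm_sum_le F fun n => star (θ n s) * φ n s'
    _ ≤ _ := Finset.sum_mul_sq_le_sq_mul_sq F _ _

end Kernel

section KernelOperator

variable {ι α β : Type*} [MeasurableSpace α] {μ : Measure α}

/-- The action `∫ v(s') transition(s, s') ds'` of the transition kernel on a function `v`. -/
noncomputable def transitionIntegral (μ : Measure α) (θ : ι → β → ℂ) (φ : ι → α → ℂ) (F : Finset ι)
    (v : α → ℝ) (s : β) : ℝ :=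
  ∫ s', v s' * transition θ φ F s s' ∂μ

theorem transitionIntegral_nonneg {v : α → ℝ} (hv0 : 0 ≤ᵐ[μ] v) (θ : ι → β → ℂ) (φ : ι → α → ℂ)
    (F : Finset ι) (s : β) : 0 ≤ transitionIntegral μ θ φ F v s :=
  integral_nonneg_of_ae <| hv0.mono fun s' hs' => mul_nonneg hs' (transition_nonneg θ φ F s s')

theorem IsOrthonormalSystem.integrable_diagAverage [DecidableEq ι] {φ : ι → α → ℂ}
    (hφ : IsOrthonormalSystem μ φ) (F : Finset ι) : Integrable (diagAverage φ F) μ :=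
  integrable_expect fun n _ => hφ.integrable_norm_sq n

theorem IsOrthonormalSystem.integral_diagAverage [DecidableEq ι] {φ : ι → α → ℂ}
    {F : Finset ι} (hφ : IsOrthonormalSystem μ φ) (hF : F.Nonempty) :
    ∫ s, diagAverage φ F s ∂μ = 1 := by
  simp only [diagAverage]
  rw [integral_expect fun n _ => hφ.integrable_norm_sq n]
  simp only [hφ.integral_norm_sq, Finset.expect_const hF]

theorem IsOrthonormalSystem.integral_transition [DecidableEq ι] {φ : ι → α → ℂ}
    (hφ : IsOrthonormalSystem μ φ) (θ : ι → β → ℂ) (F : Finset ι) (s : β) :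
    ∫ s', transition θ φ F s s' ∂μ = diagAverage θ F s := by
  simp only [transition, diagAverage]
  rw [integral_div, hφ.integral_norm_sq_sum, Finset.expect_eq_sum_div_card]
  simp only [norm_star]

variable [MeasurableSpace β] {ν : Measure β} {θ : ι → β → ℂ} {φ : ι → α → ℂ} {F : Finset ι}
  {v : α → ℝ}

theorem integrable_mul_transition [SFinite μ] (hθ : ∀ n, MemLp (θ n) 2 ν)
    (hφ : ∀ n, AEStronglyMeasurable (φ n) μ) (hv : AEStronglyMeasurable v μ)
    (hvφ : Integrable (fun s' => v s' * diagAverage φ F s') μ) :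
    Integrable (fun z : β × α => v z.2 * transition θ φ F z.1 z.2) (ν.prod μ) := by
  have hθsum : Integrable (fun s => ∑ n ∈ F, ‖θ n s‖ ^ 2) ν :=
    integrable_finsetSum F fun n _ => (hθ n).norm.integrable_sq
  have hmeas : AEStronglyMeasurable (fun z : β × α => transition θ φ F z.1 z.2) (ν.prod μ) :=
    ((Finset.aestronglyMeasurable_fun_sum F fun n _ =>
      (hθ n).1.comp_fst.star.mul (hφ n).comp_snd).norm.pow 2).div₀ aestronglyMeasurable_const
  refine (hθsum.mul_prod hvφ).mono (hv.comp_snd.mul hmeas) (.of_forall fun z => ?_)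
  rw [norm_mul, norm_mul, norm_mul, Real.norm_of_nonneg (transition_nonneg θ φ F _ _),
    Real.norm_of_nonneg (diagAverage_nonneg φ F _),
    Real.norm_of_nonneg (show 0 ≤ ∑ n ∈ F, ‖θ n z.1‖ ^ 2 by positivity), mul_left_comm]
  gcongr
  exact transition_le θ φ F z.1 z.2

theorem integrable_transitionIntegral [SFinite μ] [SFinite ν] (hθ : ∀ n, MemLp (θ n) 2 ν)
    (hφ : ∀ n, AEStronglyMeasurable (φ n) μ) (hv : AEStronglyMeasurable v μ)
    (hvφ : Integrable (fun s' => v s' * diagAverage φ F s') μ) :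
    Integrable (transitionIntegral μ θ φ F v) ν :=
  (integrable_mul_transition hθ hφ hv hvφ).integral_prod_left

variable [DecidableEq ι]

theorem integral_transitionIntegral [SFinite μ] [SFinite ν] (hθ : IsOrthonormalSystem ν θ)
    (hφ : ∀ n, AEStronglyMeasurable (φ n) μ) (hv : AEStronglyMeasurable v μ)
    (hvφ : Integrable (fun s' => v s' * diagAverage φ F s') μ) :
    ∫ s, transitionIntegral μ θ φ F v s ∂ν = ∫ s', v s' * diagAverage φ F s' ∂μ := by
  simp only [transitionIntegral]
  rw [integral_integral_swap (integrable_mul_transition hθ.memLp hφ hv hvφ)]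
  simp_rw [integral_const_mul, transition_comm θ φ, hθ.integral_transition]

theorem integrable_map_transitionIntegral_and_integral_le [SFinite μ] [SFinite ν] {Φ : ℝ → ℝ}
    (hΦ : ConvexOn ℝ (Set.Ici 0) Φ) (hΦc : Continuous Φ) (hΦ0 : ∀ t, 0 ≤ t → 0 ≤ Φ t)
    (hθ : IsOrthonormalSystem ν θ) (hφ : IsOrthonormalSystem μ φ)
    (hv : AEStronglyMeasurable v μ) (hv0 : 0 ≤ᵐ[μ] v)
    (hvφ : Integrable (fun s' => v s' * diagAverage φ F s') μ)
    (hΦvφ : Integrable (fun s' => Φ (v s') * diagAverage φ F s') μ) :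
    Integrable (fun s => Φ (transitionIntegral μ θ φ F v s / diagAverage θ F s) *
        diagAverage θ F s) ν ∧
      ∫ s, Φ (transitionIntegral μ θ φ F v s / diagAverage θ F s) * diagAverage θ F s ∂ν ≤
        ∫ s', Φ (v s') * diagAverage φ F s' ∂μ := by
  have hφm (n : ι) : AEStronglyMeasurable (φ n) μ := (hφ.memLp n).1
  have hΦv : AEStronglyMeasurable (fun s' => Φ (v s')) μ := hΦc.comp_aestronglyMeasurable hv
  have hTΦ : Integrable (transitionIntegral μ θ φ F fun s' => Φ (v s')) ν :=
    integrable_transitionIntegral hθ.memLp hφm hΦv hΦvφ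
  have hT0 (s : β) : 0 ≤ transitionIntegral μ θ φ F v s / diagAverage θ F s :=
    div_nonneg (transitionIntegral_nonneg hv0 θ φ F s) (diagAverage_nonneg θ F s)
  have Jensen : ∀ᵐ s ∂ν, Φ (transitionIntegral μ θ φ F v s / diagAverage θ F s) *
      diagAverage θ F s ≤ transitionIntegral μ θ φ F (fun s' => Φ (v s')) s := by
    filter_upwards [(integrable_mul_transition hθ.memLp hφm hv hvφ).prod_right_ae,
      (integrable_mul_transition hθ.memLp hφm hΦv hΦvφ).prod_right_ae] with s hs hΦs
    rw [← hφ.integral_transition θ F s]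
    exact map_integral_div_integral_mul_integral_le hΦ hΦc.continuousOn isClosed_Ici
      ((hφ.memLp_sum F fun n => star (θ n s)).norm.integrable_sq.div_const _)
      (.of_forall fun s' => transition_nonneg θ φ F s s') hv0 hs hΦs
  have hint : Integrable (fun s => Φ (transitionIntegral μ θ φ F v s / diagAverage θ F s) *
      diagAverage θ F s) ν := by
    have hdiag : Integrable (diagAverage θ F) ν := hθ.integrable_diagAverage F
    refine hTΦ.mono' ((hΦc.comp_aestronglyMeasurable
      ((integrable_transitionIntegral hθ.memLp hφm hv hvφ).1.div₀ hdiag.1)).mul hdiag.1) ?_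
    filter_upwards [Jensen] with s hs
    rwa [Real.norm_of_nonneg (mul_nonneg (hΦ0 _ (hT0 s)) (diagAverage_nonneg θ F s))]
  exact ⟨hint, (integral_mono_ae hint hTΦ Jensen).trans_eq
    (integral_transitionIntegral hθ hφm hΦv hΦvφ)⟩

end KernelOperator

section Tails

variable {G : Type*} [AddCommGroup G] [DecidableEq G]

theorem expect_tsum_notMem_eq {b : G → ℝ} (hb : Summable b) (F : Finset G) :
    𝔼 k ∈ F, ∑' l : {l // l ∉ F}, b (k - l) = ∑' m, (#{k ∈ F | k - m ∉ F} / #F : ℝ) * b m := by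
  have row (k : G) : ∑' l : {l // l ∉ F}, b (k - l) = ∑' m, if k - m ∉ F then b m else 0 := by
    refine (tsum_subtype {l | l ∉ F} fun l => b (k - l)).trans ?_
    rw [← (Equiv.subLeft k).tsum_eq]
    simp [Set.indicator_apply]
  have summable_row (k : G) : Summable fun m => if k - m ∉ F then b m else 0 :=
    (hb.indicator {m | k - m ∉ F}).congr fun m => by simp [Set.indicator_apply]
  simp_rw [Finset.expect_eq_sum_div_card, row]
  rw [← Summable.tsum_finsetSum fun k _ => summable_row k, ← tsum_div_const]
  refine tsum_congr fun m => ?_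
  rw [← Finset.sum_filter, Finset.sum_const, nsmul_eq_mul, div_mul_eq_mul_div]

theorem tendsto_expect_tsum_notMem {W : ℕ → Finset G}
    (hW : ∀ m, Tendsto (fun M => (#{k ∈ W M | k - m ∉ W M} / #(W M) : ℝ)) atTop (𝓝 0))
    {b : G → ℝ} (hb : Summable b) :
    Tendsto (fun M => 𝔼 k ∈ W M, ∑' l : {l // l ∉ W M}, b (k - l)) atTop (𝓝 0) := by
  simp_rw [expect_tsum_notMem_eq hb]
  suffices Tendsto (fun M => ∑' m, (#{k ∈ W M | k - m ∉ W M} / #(W M) : ℝ) * b m) atTop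
      (𝓝 (∑' _ : G, 0)) by
    simpa only [tsum_zero] using this
  refine tendsto_tsum_of_dominated_convergence hb.norm
    (fun m => by simpa using (hW m).mul_const (b m)) (.of_forall fun M m => ?_)
  rw [norm_mul, Real.norm_of_nonneg (by positivity)]
  refine mul_le_of_le_one_left (norm_nonneg _) (div_le_one_of_le₀ ?_ (by positivity))
  exact_mod_cast Finset.card_filter_le (W M) fun k => k - m ∉ W M

theorem card_window (M : ℕ) : #(window M) = 2 * M := by
  simp only [window, Int.card_Ico]; omega

theorem tendsto_window_atTop : Tendsto window atTop atTop := by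
  refine tendsto_atTop_finset_of_monotone (fun M M' h => ?_) fun n => ⟨n.natAbs + 1, ?_⟩
  · exact Finset.Ico_subset_Ico (by omega) (by omega)
  · simp only [window, Finset.mem_Ico]; omega

theorem card_filter_sub_notMem_window_le (M : ℕ) (m : ℤ) :
    #{k ∈ window M | k - m ∉ window M} ≤ m.natAbs := by
  rcases le_total 0 m with hm | hm
  · calc #{k ∈ window M | k - m ∉ window M} ≤ #(Finset.Ico (-(M : ℤ)) (-M + m)) := by
          refine Finset.card_le_card fun k hk => ?_
          simp only [window, Finset.mem_filter, Finset.mem_Ico] at hk ⊢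
          omega
      _ = m.natAbs := by rw [Int.card_Ico]; omega
  · calc #{k ∈ window M | k - m ∉ window M} ≤ #(Finset.Ico ((M : ℤ) + m) M) := by
          refine Finset.card_le_card fun k hk => ?_
          simp only [window, Finset.mem_filter, Finset.mem_Ico] at hk ⊢
          omega
      _ = m.natAbs := by rw [Int.card_Ico]; omega

theorem tendsto_card_filter_sub_notMem_window_div (m : ℤ) :
    Tendsto (fun M => (#{k ∈ window M | k - m ∉ window M} / #(window M) : ℝ)) atTop (𝓝 0) := by
  have hcard : Tendsto (fun M => (#(window M) : ℝ)) atTop atTop := by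
    simp_rw [card_window, Nat.cast_mul]
    exact tendsto_natCast_atTop_atTop.const_mul_atTop (by norm_num)
  refine squeeze_zero (fun M => by positivity) (fun M => ?_)
    (hcard.const_div_atTop (m.natAbs : ℝ))
  gcongr
  exact card_filter_sub_notMem_window_le M m

end Tails

section Rows

variable {ι : Type*}

/-- The rows of the matrix `R` have square sum at most `A`, and on average over the window `W M`
only a vanishing part of this mass lies outside the window. -/
structure HasNegligibleTails (W : ℕ → Finset ι) (R : ι → ι → ℂ) (A : ℝ) : Prop where
  summable : ∀ k, Summable fun l => ‖R k l‖ ^ 2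
  tsum_le : ∀ k, ∑' l, ‖R k l‖ ^ 2 ≤ A
  tendsto_tail : Tendsto (fun M => 𝔼 k ∈ W M, ∑' l : {l // l ∉ W M}, ‖R k l‖ ^ 2) atTop (𝓝 0)

theorem HasNegligibleTails.nonneg [Nonempty ι] {W : ℕ → Finset ι} {R : ι → ι → ℂ} {A : ℝ}
    (hR : HasNegligibleTails W R A) : 0 ≤ A :=
  (tsum_nonneg fun _ => by positivity).trans (hR.tsum_le (Classical.arbitrary ι))

theorem hasNegligibleTails_window {R : ℤ → ℤ → ℂ} {b : ℤ → ℝ} (hb : Summable b)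
    (hR : ∀ k l, ‖R k l‖ ^ 2 ≤ b (k - l)) : HasNegligibleTails window R (∑' m, b m) := by
  have summable_sub (k : ℤ) : Summable fun l => b (k - l) := (Equiv.subLeft k).summable_iff.2 hb
  have summable_row (k : ℤ) : Summable fun l => ‖R k l‖ ^ 2 :=
    (summable_sub k).of_nonneg_of_le (fun l => by positivity) (hR k)
  refine ⟨summable_row, fun k => ?_, ?_⟩
  · rw [← (Equiv.subLeft k).tsum_eq b]
    exact (summable_row k).tsum_le_tsum (hR k) (summable_sub k)
  · refine squeeze_zero
      (fun M => Finset.expect_nonneg fun k _ => tsum_nonneg fun l => by positivity)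
      (fun M => Finset.expect_le_expect fun k _ => ?_)
      (tendsto_expect_tsum_notMem tendsto_card_filter_sub_notMem_window_div hb)
    exact ((summable_row k).subtype _).tsum_le_tsum (fun l => hR k l) ((summable_sub k).subtype _)

end Rows

section Normalized

variable {ι α : Type*} [DecidableEq ι] [MeasurableSpace α] {μ : Measure α} {W : ℕ → Finset ι}
  {θ : ι → α → ℂ}

/-- An orthonormal system for which the diagonal of the resolution of the identity over the window
`W M` tends to `1` in measure. -/
structure IsNormalizedSystem (μ : Measure α) (W : ℕ → Finset ι) (θ : ι → α → ℂ) : Prop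
    extends IsOrthonormalSystem μ θ where
  normalized : TendstoInMeasure μ (fun M => diagAverage θ (W M)) atTop 1

theorem IsNormalizedSystem.tendsto_integral_abs_diagAverage_sub_one [Nonempty ι]
    [IsProbabilityMeasure μ] (hθ : IsNormalizedSystem μ W θ) (hW : Tendsto W atTop atTop) :
    Tendsto (fun M => ∫ s, |diagAverage θ (W M) s - 1| ∂μ) atTop (𝓝 0) := by
  refine tendsto_integral_abs_sub_of_tendsto_integral (fun M => hθ.integrable_diagAverage (W M))
    (fun M => .of_forall (diagAverage_nonneg θ (W M))) (integrable_const 1) ?_ hθ.normalized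
  have i : ι := Classical.arbitrary ι
  refine tendsto_const_nhds.congr' ?_
  filter_upwards [hW.eventually_ge_atTop {i}] with M hM
  simp [hθ.integral_diagAverage ((Finset.singleton_nonempty i).mono hM)]

end Normalized

section Diagonalized

variable {ι α : Type*} [DecidableEq ι] [MeasurableSpace α] {μ : Measure α} {W : ℕ → Finset ι}
  {R : ι → ι → ℂ} {A : ℝ} {φ : ι → α → ℂ} {S : α → ℝ}

/-- The normalized system `φ` diagonalizes the matrix `R`, which acts as multiplication by `S`. The
rows of the eigenequation are summed along the windows `W`. -/
structure IsDiagonalized (μ : Measure α) (W : ℕ → Finset ι) (R : ι → ι → ℂ) (φ : ι → α → ℂ)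
    (S : α → ℝ) : Prop extends IsNormalizedSystem μ W φ where
  eigen : ∀ k, TendstoInMeasure μ (fun M s => ∑ l ∈ W M, R k l * φ l s) atTop
    fun s => (S s : ℂ) * φ k s

namespace IsDiagonalized

theorem memLp_mul (hφ : IsDiagonalized μ W R φ S) (hW : Tendsto W atTop atTop)
    (hR : HasNegligibleTails W R A) (k : ι) : MemLp (fun s => (S s : ℂ) * φ k s) 2 μ :=
  hφ.memLp_of_tendstoInMeasure hW (hR.summable k) (hφ.eigen k)

theorem integrable_mul_mul_star (hφ : IsDiagonalized μ W R φ S) (hW : Tendsto W atTop atTop)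
    (hR : HasNegligibleTails W R A) (k l : ι) :
    Integrable (fun s => (S s : ℂ) * (φ k s * star (φ l s))) μ := by
  simpa only [mul_assoc] using integrable_mul_star (hφ.memLp_mul hW hR k) (hφ.memLp l)

theorem integral_mul_mul_star (hφ : IsDiagonalized μ W R φ S) (hW : Tendsto W atTop atTop)
    (hR : HasNegligibleTails W R A) (k l : ι) :
    ∫ s, (S s : ℂ) * (φ k s * star (φ l s)) ∂μ = R k l := by
  simpa only [mul_assoc] using
    hφ.integral_mul_star_of_tendstoInMeasure hW (hR.summable k) (hφ.eigen k) l

theorem integrable_sq_mul_norm_sq (hφ : IsDiagonalized μ W R φ S) (hW : Tendsto W atTop atTop)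
    (hR : HasNegligibleTails W R A) (k : ι) : Integrable (fun s => S s ^ 2 * ‖φ k s‖ ^ 2) μ := by
  simpa [mul_pow] using (hφ.memLp_mul hW hR k).norm.integrable_sq

theorem integral_sq_mul_norm_sq_le (hφ : IsDiagonalized μ W R φ S) (hW : Tendsto W atTop atTop)
    (hR : HasNegligibleTails W R A) (k : ι) : ∫ s, S s ^ 2 * ‖φ k s‖ ^ 2 ∂μ ≤ A := by
  have h := (hφ.integrable_norm_sq_sub_sum_and_integral_le hW (hR.summable k) (hφ.eigen k) ∅).2
  refine le_trans ?_ (h.trans ((hR.summable k).tsum_subtype_le _ _ (fun l => by positivity)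
    |>.trans (hR.tsum_le k)))
  simp [mul_pow]

theorem integrable_sq_mul_diagAverage (hφ : IsDiagonalized μ W R φ S) (hW : Tendsto W atTop atTop)
    (hR : HasNegligibleTails W R A) (F : Finset ι) :
    Integrable (fun s => S s ^ 2 * diagAverage φ F s) μ := by
  simp only [diagAverage, Finset.mul_expect]
  exact integrable_expect fun k _ => hφ.integrable_sq_mul_norm_sq hW hR k

theorem integral_sq_mul_diagAverage_le [Nonempty ι] (hφ : IsDiagonalized μ W R φ S)
    (hW : Tendsto W atTop atTop) (hR : HasNegligibleTails W R A) (F : Finset ι) :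
    ∫ s, S s ^ 2 * diagAverage φ F s ∂μ ≤ A := by
  simp only [diagAverage, Finset.mul_expect]
  rw [integral_expect fun k _ => hφ.integrable_sq_mul_norm_sq hW hR k]
  rcases F.eq_empty_or_nonempty with rfl | hF
  · simpa using hR.nonneg
  · exact Finset.expect_le hF fun k _ => hφ.integral_sq_mul_norm_sq_le hW hR k

theorem aestronglyMeasurable (hφ : IsDiagonalized μ W R φ S) (hW : Tendsto W atTop atTop)
    (hR : HasNegligibleTails W R A) : AEStronglyMeasurable S μ := by
  have hmul (k : ι) : AEStronglyMeasurable (fun s => S s * ‖φ k s‖ ^ 2) μ := by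
    refine (hφ.integrable_mul_mul_star hW hR k k).re.1.congr (.of_forall fun s => ?_)
    simp only [← ofReal_norm_sq_eq_mul_star, ← Complex.ofReal_mul]
    exact Complex.ofReal_re _
  have havg (F : Finset ι) : AEStronglyMeasurable (fun s => S s * diagAverage φ F s) μ := by
    simp only [diagAverage, Finset.expect_eq_sum_div_card, ← mul_div_assoc, Finset.mul_sum]
    exact (Finset.aestronglyMeasurable_fun_sum F fun k _ => hmul k).div₀
      aestronglyMeasurable_const
  obtain ⟨ns, -, hns⟩ := hφ.normalized.exists_seq_tendsto_ae
  refine aestronglyMeasurable_of_tendsto_ae atTop (fun n => havg (W (ns n))) ?_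
  filter_upwards [hns] with s hs
  simpa using hs.const_mul (S s)

theorem integrable_sq [Nonempty ι] (hφ : IsDiagonalized μ W R φ S) (hW : Tendsto W atTop atTop)
    (hR : HasNegligibleTails W R A) : Integrable (fun s => S s ^ 2) μ := by
  obtain ⟨ns, -, hns⟩ := hφ.normalized.exists_seq_tendsto_ae
  refine (integrable_and_integral_le_of_tendsto
    (fun n => hφ.integrable_sq_mul_diagAverage hW hR (W (ns n)))
    (fun n => .of_forall fun s => mul_nonneg (sq_nonneg _) (diagAverage_nonneg φ _ s))
    (fun n => hφ.integral_sq_mul_diagAverage_le hW hR _) tendsto_const_nhds ?_).1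
  filter_upwards [hns] with s hs
  simpa using hs.const_mul (S s ^ 2)

theorem integrable_mul_diagAverage (hφ : IsDiagonalized μ W R φ S) (hW : Tendsto W atTop atTop)
    (hR : HasNegligibleTails W R A) {f : α → ℝ} (hf : AEStronglyMeasurable f μ)
    (hfS : IsSubordinate μ f fun s => S s ^ 2) (F : Finset ι) :
    Integrable (fun s => f s * diagAverage φ F s) μ :=
  hfS.integrable_mul hf (hφ.integrable_diagAverage F) (diagAverage_nonneg φ F)
    (hφ.integrable_sq_mul_diagAverage hW hR F)

theorem integrable_self_mul_diagAverage (hφ : IsDiagonalized μ W R φ S)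
    (hW : Tendsto W atTop atTop) (hR : HasNegligibleTails W R A) (F : Finset ι) :
    Integrable (fun s => S s * diagAverage φ F s) μ :=
  hφ.integrable_mul_diagAverage hW hR (hφ.aestronglyMeasurable hW hR) (isSubordinate_sq S) F

variable [Nonempty ι] [IsProbabilityMeasure μ]

theorem integrable (hφ : IsDiagonalized μ W R φ S) (hW : Tendsto W atTop atTop)
    (hR : HasNegligibleTails W R A) : Integrable S μ :=
  (isSubordinate_sq S).integrable (hφ.aestronglyMeasurable hW hR) (hφ.integrable_sq hW hR)

theorem tendsto_integral_abs_mul_diagAverage_sub (hφ : IsDiagonalized μ W R φ S)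
    (hW : Tendsto W atTop atTop) (hR : HasNegligibleTails W R A) {f : α → ℝ}
    (hf : AEStronglyMeasurable f μ) (hfS : IsSubordinate μ f fun s => S s ^ 2) :
    Tendsto (fun M => ∫ s, |f s * diagAverage φ (W M) s - f s| ∂μ) atTop (𝓝 0) :=
  hfS.tendsto_integral_abs_mul_sub hf (fun M => hφ.integrable_diagAverage (W M))
    (fun M => diagAverage_nonneg φ (W M)) (hφ.tendsto_integral_abs_diagAverage_sub_one hW)
    (fun s => sq_nonneg (S s)) (hφ.integrable_sq hW hR)
    (fun M => hφ.integrable_sq_mul_diagAverage hW hR (W M))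
    fun M => hφ.integral_sq_mul_diagAverage_le hW hR (W M)

theorem tendsto_integral_mul_diagAverage (hφ : IsDiagonalized μ W R φ S)
    (hW : Tendsto W atTop atTop) (hR : HasNegligibleTails W R A) {f : α → ℝ}
    (hf : AEStronglyMeasurable f μ) (hfS : IsSubordinate μ f fun s => S s ^ 2) :
    Tendsto (fun M => ∫ s, f s * diagAverage φ (W M) s ∂μ) atTop (𝓝 (∫ s, f s ∂μ)) := by
  rw [tendsto_iff_norm_sub_tendsto_zero]
  refine squeeze_zero (fun _ => norm_nonneg _) (fun M => ?_)
    (hφ.tendsto_integral_abs_mul_diagAverage_sub hW hR hf hfS)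
  rw [← integral_sub (hφ.integrable_mul_diagAverage hW hR hf hfS _)
    (hfS.integrable hf (hφ.integrable_sq hW hR))]
  exact norm_integral_le_integral_norm _

end IsDiagonalized

end Diagonalized

theorem expect_sqrt_le_sqrt_expect {ι : Type*} {F : Finset ι} {a : ι → ℝ}
    (ha : ∀ k ∈ F, 0 ≤ a k) : 𝔼 k ∈ F, √(a k) ≤ √(𝔼 k ∈ F, a k) := by
  refine Real.le_sqrt_of_sq_le ?_
  calc (𝔼 k ∈ F, √(a k)) ^ 2 = (𝔼 k ∈ F, √(a k) * 1) ^ 2 := by simp only [mul_one]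
    _ ≤ (𝔼 k ∈ F, √(a k) ^ 2) * 𝔼 _k ∈ F, 1 ^ 2 := Finset.expect_mul_sq_le_sq_mul_sq F _ _
    _ = 𝔼 k ∈ F, a k := by
        rw [Finset.expect_congr rfl fun k hk => Real.sq_sqrt (ha k hk)]
        rcases F.eq_empty_or_nonempty with rfl | hF
        · simp
        · rw [Finset.expect_const hF, one_pow, mul_one]

section DiagonalTransition

variable {ι α : Type*} [DecidableEq ι] [MeasurableSpace α] {μ : Measure α} {W : ℕ → Finset ι}
  {R : ι → ι → ℂ} {A : ℝ} {φ : ι → α → ℂ} {S : α → ℝ}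

namespace IsDiagonalized

theorem ofReal_transitionIntegral {β : Type*} (hφ : IsDiagonalized μ W R φ S)
    (hW : Tendsto W atTop atTop) (hR : HasNegligibleTails W R A) (θ : ι → β → ℂ) (F : Finset ι)
    (s : β) : (transitionIntegral μ θ φ F S s : ℂ) =
      (∑ k ∈ F, ∑ l ∈ F, star (θ k s) * θ l s * R k l) / #F := by
  simp only [transitionIntegral, transition, ← mul_div_assoc]
  rw [integral_div, Complex.ofReal_div, ofReal_integral_mul_norm_sq_sum
    (hφ.integrable_mul_mul_star hW hR), Complex.ofReal_natCast]
  simp only [hφ.integral_mul_mul_star hW hR, star_star]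

theorem abs_transitionIntegral_sub_mul_diagAverage_le (hφ : IsDiagonalized μ W R φ S)
    (hW : Tendsto W atTop atTop) (hR : HasNegligibleTails W R A) (F : Finset ι) (s : α) :
    |transitionIntegral μ φ φ F S s - S s * diagAverage φ F s| ≤
      𝔼 k ∈ F, ‖(S s : ℂ) * φ k s - ∑ l ∈ F, R k l * φ l s‖ * ‖φ k s‖ := by
  have hdiff : ((S s * diagAverage φ F s - transitionIntegral μ φ φ F S s : ℝ) : ℂ) =
      (∑ k ∈ F, ((S s : ℂ) * φ k s - ∑ l ∈ F, R k l * φ l s) * star (φ k s)) / #F := by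
    rw [Complex.ofReal_sub, hφ.ofReal_transitionIntegral hW hR, diagAverage,
      Finset.expect_eq_sum_div_card, Complex.ofReal_mul, Complex.ofReal_div,
      Complex.ofReal_natCast, Complex.ofReal_sum, ← mul_div_assoc, ← sub_div, Finset.mul_sum,
      ← Finset.sum_sub_distrib]
    congr 1
    refine Finset.sum_congr rfl fun k _ => ?_
    rw [ofReal_norm_sq_eq_mul_star, sub_mul, mul_assoc, Finset.sum_mul]
    congr 1
    exact Finset.sum_congr rfl fun l _ => by ring
  rw [abs_sub_comm, ← Real.norm_eq_abs, ← Complex.norm_real, hdiff,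
    Finset.expect_eq_sum_div_card, norm_div, Complex.norm_natCast]
  gcongr
  simpa only [norm_mul, norm_star] using norm_sum_le F fun k =>
    ((S s : ℂ) * φ k s - ∑ l ∈ F, R k l * φ l s) * star (φ k s)

theorem integral_abs_transitionIntegral_sub_mul_diagAverage_le (hφ : IsDiagonalized μ W R φ S)
    (hW : Tendsto W atTop atTop) (hR : HasNegligibleTails W R A) (F : Finset ι) :
    ∫ s, |transitionIntegral μ φ φ F S s - S s * diagAverage φ F s| ∂μ ≤
      √(𝔼 k ∈ F, ∑' l : {l // l ∉ F}, ‖R k l‖ ^ 2) := by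
  set residual : ι → α → ℂ := fun k s => (S s : ℂ) * φ k s - ∑ l ∈ F, R k l * φ l s
  have hres (k : ι) : MemLp (residual k) 2 μ := (hφ.memLp_mul hW hR k).sub (hφ.memLp_sum F (R k))
  have hint (k : ι) : Integrable (fun s => ‖residual k s‖ * ‖φ k s‖) μ :=
    (hres k).norm.integrable_mul (hφ.memLp k).norm
  have row_le (k : ι) :
      ∫ s, ‖residual k s‖ * ‖φ k s‖ ∂μ ≤ √(∑' l : {l // l ∉ F}, ‖R k l‖ ^ 2) := by
    refine (integral_norm_mul_norm_le_sqrt_mul_sqrt (hres k) (hφ.memLp k)).trans ?_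
    rw [hφ.integral_norm_sq, Real.sqrt_one, mul_one]
    exact Real.sqrt_le_sqrt
      (hφ.integrable_norm_sq_sub_sum_and_integral_le hW (hR.summable k) (hφ.eigen k) F).2
  calc ∫ s, |transitionIntegral μ φ φ F S s - S s * diagAverage φ F s| ∂μ
      ≤ ∫ s, 𝔼 k ∈ F, ‖residual k s‖ * ‖φ k s‖ ∂μ :=
        integral_mono_of_nonneg (.of_forall fun s => abs_nonneg _)
          (integrable_expect fun k _ => hint k)
          (.of_forall (hφ.abs_transitionIntegral_sub_mul_diagAverage_le hW hR F))
    _ = 𝔼 k ∈ F, ∫ s, ‖residual k s‖ * ‖φ k s‖ ∂μ := integral_expect fun k _ => hint k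
    _ ≤ 𝔼 k ∈ F, √(∑' l : {l // l ∉ F}, ‖R k l‖ ^ 2) :=
        Finset.expect_le_expect fun k _ => row_le k
    _ ≤ √(𝔼 k ∈ F, ∑' l : {l // l ∉ F}, ‖R k l‖ ^ 2) := expect_sqrt_le_sqrt_expect
        fun k _ => tsum_nonneg fun l => by positivity

variable [Nonempty ι] [IsProbabilityMeasure μ]

theorem tendstoInMeasure_transitionIntegral (hφ : IsDiagonalized μ W R φ S)
    (hW : Tendsto W atTop atTop) (hR : HasNegligibleTails W R A) :
    TendstoInMeasure μ (fun M => transitionIntegral μ φ φ (W M) S) atTop S := by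
  have hSm : AEStronglyMeasurable S μ := hφ.aestronglyMeasurable hW hR
  have hS : Integrable S μ := hφ.integrable hW hR
  have hSg (M : ℕ) : Integrable (fun s => S s * diagAverage φ (W M) s) μ :=
    hφ.integrable_self_mul_diagAverage hW hR (W M)
  have hT (M : ℕ) : Integrable (transitionIntegral μ φ φ (W M) S) μ :=
    integrable_transitionIntegral hφ.memLp (fun n => (hφ.memLp n).1) hSm (hSg M)
  refine tendstoInMeasure_of_tendsto_integral_abs hT hS ?_
  have hlim := hR.tendsto_tail.sqrt.add
    (hφ.tendsto_integral_abs_mul_diagAverage_sub hW hR hSm (isSubordinate_sq S))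
  rw [Real.sqrt_zero, add_zero] at hlim
  refine squeeze_zero (fun M => integral_nonneg fun s => abs_nonneg _) (fun M => ?_) hlim
  calc ∫ s, |transitionIntegral μ φ φ (W M) S s - S s| ∂μ
      ≤ ∫ s, (|transitionIntegral μ φ φ (W M) S s - S s * diagAverage φ (W M) s| +
          |S s * diagAverage φ (W M) s - S s|) ∂μ :=
        integral_mono ((hT M).sub hS).abs (((hT M).sub (hSg M)).abs.add ((hSg M).sub hS).abs)
          fun s => abs_sub_le _ _ _
    _ = ∫ s, |transitionIntegral μ φ φ (W M) S s - S s * diagAverage φ (W M) s| ∂μ +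
          ∫ s, |S s * diagAverage φ (W M) s - S s| ∂μ :=
        integral_add ((hT M).sub (hSg M)).abs ((hSg M).sub hS).abs
    _ ≤ _ := by
        gcongr
        exact hφ.integral_abs_transitionIntegral_sub_mul_diagAverage_le hW hR (W M)

end IsDiagonalized

end DiagonalTransition

section ConvexOrder

variable {ι α β : Type*} [DecidableEq ι] [Nonempty ι] [MeasurableSpace α] [MeasurableSpace β]
  {μ : Measure α} {ν : Measure β} [IsProbabilityMeasure μ] {W : ℕ → Finset ι} {R : ι → ι → ℂ}
  {A : ℝ} {φ : ι → α → ℂ} {θ : ι → β → ℂ} {S : α → ℝ} {T : β → ℝ}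

namespace IsDiagonalized

theorem integrable_map_and_integral_map_le [SFinite ν] (hφ : IsDiagonalized μ W R φ S)
    (hW : Tendsto W atTop atTop) (hR : HasNegligibleTails W R A) (hS0 : 0 ≤ᵐ[μ] S)
    (hθ : IsNormalizedSystem ν W θ)
    (hT : TendstoInMeasure ν (fun M => transitionIntegral μ θ φ (W M) S) atTop T) {Φ : ℝ → ℝ}
    (hΦ : ConvexOn ℝ (Set.Ici 0) Φ) (hΦc : Continuous Φ) (hΦ0 : ∀ t, 0 ≤ t → 0 ≤ Φ t)
    (hΦ2 : Φ =o[atTop] fun t => t ^ 2) :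
    Integrable (fun s => Φ (T s)) ν ∧ ∫ s, Φ (T s) ∂ν ≤ ∫ s, Φ (S s) ∂μ := by
  have hSm : AEStronglyMeasurable S μ := hφ.aestronglyMeasurable hW hR
  have hΦSm : AEStronglyMeasurable (fun s => Φ (S s)) μ := hΦc.comp_aestronglyMeasurable hSm
  have hΦS : IsSubordinate μ (fun s => Φ (S s)) fun s => S s ^ 2 :=
    isSubordinate_comp_sq hΦc hΦ2 hS0
  obtain ⟨ns, hns, hTns⟩ := hT.exists_seq_tendsto_ae
  obtain ⟨ms, hms, hθms⟩ := (hθ.normalized.comp hns.tendsto_atTop).exists_seq_tendsto_ae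
  have hMs : Tendsto (ns ∘ ms) atTop atTop := hns.tendsto_atTop.comp hms.tendsto_atTop
  have Jensen (M : ℕ) := integrable_map_transitionIntegral_and_integral_le hΦ hΦc hΦ0
    hθ.toIsOrthonormalSystem hφ.toIsOrthonormalSystem hSm hS0
    (hφ.integrable_self_mul_diagAverage hW hR (W M))
    (hφ.integrable_mul_diagAverage hW hR hΦSm hΦS (W M))
  refine integrable_and_integral_le_of_tendsto (fun n => (Jensen (ns (ms n))).1)
    (fun n => .of_forall fun s => mul_nonneg (hΦ0 _ (div_nonneg ?_ ?_)) ?_)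
    (fun n => (Jensen (ns (ms n))).2)
    ((hφ.tendsto_integral_mul_diagAverage hW hR hΦSm hΦS).comp hMs) ?_
  · exact transitionIntegral_nonneg hS0 θ φ _ s
  · exact diagAverage_nonneg θ _ s
  · exact diagAverage_nonneg θ _ s
  · filter_upwards [hTns, hθms] with s hTs hθs
    have hquot := (hTs.comp hms.tendsto_atTop).div hθs one_ne_zero
    simpa using ((hΦc.tendsto _).comp hquot).mul hθs

end IsDiagonalized

theorem convexOn_max_const_sub (r : ℝ) (D : Set ℝ) (hD : Convex ℝ D) :
    ConvexOn ℝ D fun t => max (r - t) 0 :=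
  (((convexOn_const r hD).sub (concaveOn_id hD)).sup (convexOn_const 0 hD))

theorem integral_max_const_sub {S : α → ℝ} (hS : Integrable S μ) (r : ℝ) :
    ∫ s, max (r - S s) 0 ∂μ = r - ∫ s, S s ∂μ + ∫ s, max (S s - r) 0 ∂μ := by
  have max_eq (s : α) : max (r - S s) 0 = r - S s + max (S s - r) 0 := by
    rcases le_total r (S s) with h | h
    · rw [max_eq_right (by linarith), max_eq_left (by linarith)]; ring
    · rw [max_eq_left (by linarith), max_eq_right (by linarith)]; ring
  have hrS : Integrable (fun s => r - S s) μ := (integrable_const r).sub hS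
  have hSr : Integrable (fun s => max (S s - r) 0) μ := (hS.sub (integrable_const r)).pos_part
  simp_rw [max_eq]
  rw [integral_add hrS hSr, integral_sub (integrable_const r) hS, integral_const, probReal_univ,
    one_smul]

theorem tendsto_integral_max_sub_const {S : α → ℝ} (hS : Integrable S μ) :
    Tendsto (fun r : ℝ => ∫ s, max (S s - r) 0 ∂μ) atTop (𝓝 0) := by
  suffices Tendsto (fun r : ℝ => ∫ s, max (S s - r) 0 ∂μ) atTop (𝓝 (∫ _, 0 ∂μ)) by
    simpa only [integral_zero] using this
  refine tendsto_integral_filter_of_dominated_convergence (fun s => |S s|)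
    (.of_forall fun r => (hS.sub (integrable_const r)).pos_part.1) ?_ hS.abs
    (.of_forall fun s => ?_)
  · filter_upwards [eventually_ge_atTop 0] with r hr
    refine .of_forall fun s => ?_
    rw [Real.norm_of_nonneg (le_max_right _ _)]
    exact max_le (by linarith [le_abs_self (S s)]) (abs_nonneg _)
  · refine tendsto_const_nhds.congr' ?_
    filter_upwards [eventually_ge_atTop (S s)] with r hr
    exact (max_eq_right (by linarith)).symm

namespace IsDiagonalized

theorem integrable_and_integral_eq [IsProbabilityMeasure ν] (hφ : IsDiagonalized μ W R φ S)
    (hW : Tendsto W atTop atTop) (hR : HasNegligibleTails W R A) (hS0 : 0 ≤ᵐ[μ] S)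
    (hθ : IsNormalizedSystem ν W θ)
    (hT : TendstoInMeasure ν (fun M => transitionIntegral μ θ φ (W M) S) atTop T) :
    Integrable T ν ∧ ∫ s, T s ∂ν = ∫ s, S s ∂μ := by
  have hS : Integrable S μ := hφ.integrable hW hR
  obtain ⟨hTi, hTle⟩ : Integrable T ν ∧ ∫ s, T s ∂ν ≤ ∫ s, S s ∂μ :=
    hφ.integrable_map_and_integral_map_le (Φ := fun t => t) hW hR hS0 hθ hT
      (convexOn_id (convex_Ici 0)) continuous_id (fun t ht => ht)
      (by simpa using Asymptotics.isLittleO_pow_pow_atTop_of_lt (𝕜 := ℝ) one_lt_two)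
  have trunc (r : ℝ) : ∫ s, max (r - T s) 0 ∂ν ≤ ∫ s, max (r - S s) 0 ∂μ := by
    refine (hφ.integrable_map_and_integral_map_le hW hR hS0 hθ hT
      (convexOn_max_const_sub r _ (convex_Ici 0)) (by fun_prop) (fun t _ => le_max_right _ _) ?_).2
    refine (Asymptotics.isLittleO_zero _ _).congr' ?_ .rfl
    filter_upwards [eventually_ge_atTop r] with t ht
    exact (max_eq_right (by linarith)).symm
  refine ⟨hTi, hTle.antisymm ?_⟩
  have lower (r : ℝ) : ∫ s, S s ∂μ - ∫ s, max (S s - r) 0 ∂μ ≤ ∫ s, T s ∂ν := by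
    have hT0 : 0 ≤ ∫ s, max (T s - r) 0 ∂ν := integral_nonneg fun s => le_max_right _ _
    linarith [trunc r, integral_max_const_sub hS r, integral_max_const_sub hTi r, hT0]
  simpa using le_of_tendsto' ((tendsto_integral_max_sub_const hS).const_sub (∫ s, S s ∂μ)) lower

end IsDiagonalized

end ConvexOrder

section Entropy

-- The constant `1` makes `t log t` nonnegative, as Fatou's lemma requires.
theorem convexOn_div_mul_log_div_add_one {P : ℝ} (hP : 0 < P) :
    ConvexOn ℝ (Set.Ici 0) fun t => t / P * Real.log (t / P) + 1 := by
  have h := (Real.convexOn_mul_log.comp_linearMap (P⁻¹ • LinearMap.id)).add_const 1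
  refine (h.subset (fun t ht => ?_) (convex_Ici 0)).congr fun t _ => ?_
  · simpa [inv_mul_eq_div] using div_nonneg ht hP.le
  · simp [inv_mul_eq_div]

theorem continuous_div_mul_log_div_add_one (P : ℝ) :
    Continuous fun t => t / P * Real.log (t / P) + 1 :=
  (Real.continuous_mul_log.comp (continuous_id.div_const P)).add_const 1

theorem div_mul_log_div_add_one_nonneg {P t : ℝ} (hP : 0 < P) (ht : 0 ≤ t) :
    0 ≤ t / P * Real.log (t / P) + 1 := by
  have h := Real.self_sub_one_le_mul_log (div_nonneg ht hP.le)
  linarith [div_nonneg ht hP.le]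

theorem isLittleO_div_mul_log_div_add_one {P : ℝ} (hP : 0 < P) :
    (fun t => t / P * Real.log (t / P) + 1) =o[atTop] fun t => t ^ 2 := by
  have scale : Tendsto (fun t : ℝ => t / P) atTop atTop := tendsto_id.atTop_div_const hP
  have hlog : (fun t : ℝ => t * Real.log t) =o[atTop] fun t => t ^ 2 := by
    simpa only [sq, id] using
      (Asymptotics.isBigO_refl (fun t : ℝ => t) atTop).mul_isLittleO Real.isLittleO_log_id_atTop
  have hsq : (fun t : ℝ => (t / P) ^ 2) =O[atTop] fun t => t ^ 2 := by
    simpa only [div_eq_inv_mul, mul_pow, inv_pow] using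
      Asymptotics.isBigO_const_mul_self (P ^ 2)⁻¹ (fun t : ℝ => t ^ 2) atTop
  have hone : (fun _ : ℝ => (1 : ℝ)) =o[atTop] fun t => t ^ 2 := by
    simpa only [pow_zero] using Asymptotics.isLittleO_pow_pow_atTop_of_lt (𝕜 := ℝ) two_pos
  exact ((hlog.comp_tendsto scale).trans_isBigO hsq).add hone

/-- A probability density whose differential entropy is a convergent integral. -/
structure IsEntropyDensity {α : Type*} [MeasurableSpace α] (μ : Measure α) (p : α → ℝ) : Prop where
  nonneg : 0 ≤ᵐ[μ] p
  integrable : Integrable p μ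
  integral_eq_one : ∫ s, p s ∂μ = 1
  integrable_mul_log : Integrable (fun s => p s * Real.log (p s)) μ

variable {ι α β : Type*} [DecidableEq ι] [Nonempty ι] [MeasurableSpace α] [MeasurableSpace β]
  {μ : Measure α} {ν : Measure β} [IsProbabilityMeasure μ] [IsProbabilityMeasure ν]
  {W : ℕ → Finset ι} {R : ι → ι → ℂ} {A P : ℝ} {φ : ι → α → ℂ} {θ : ι → β → ℂ} {S : α → ℝ}
  {T : β → ℝ}

namespace IsDiagonalized

theorem integrable_and_integral_div_mul_log_div_le (hφ : IsDiagonalized μ W R φ S)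
    (hW : Tendsto W atTop atTop) (hR : HasNegligibleTails W R A) (hS0 : 0 ≤ᵐ[μ] S) (hP : 0 < P)
    (hθ : IsNormalizedSystem ν W θ)
    (hT : TendstoInMeasure ν (fun M => transitionIntegral μ θ φ (W M) S) atTop T) :
    Integrable (fun s => T s / P * Real.log (T s / P)) ν ∧
      ∫ s, T s / P * Real.log (T s / P) ∂ν ≤ ∫ s, S s / P * Real.log (S s / P) ∂μ := by
  have hmap := hφ.integrable_map_and_integral_map_le hW hR hS0 hθ hT
    (convexOn_div_mul_log_div_add_one hP) (continuous_div_mul_log_div_add_one P)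
    (fun t ht => div_mul_log_div_add_one_nonneg hP ht) (isLittleO_div_mul_log_div_add_one hP)
  have hSm : AEStronglyMeasurable (fun s => S s / P * Real.log (S s / P) + 1) μ :=
    (continuous_div_mul_log_div_add_one P).comp_aestronglyMeasurable
      (hφ.aestronglyMeasurable hW hR)
  have hSlog : Integrable (fun s => S s / P * Real.log (S s / P)) μ := by
    rw [← integrable_add_const_iff (c := 1)]
    exact (isSubordinate_comp_sq (continuous_div_mul_log_div_add_one P)
      (isLittleO_div_mul_log_div_add_one hP) hS0).integrable hSm (hφ.integrable_sq hW hR)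
  have hTlog : Integrable (fun s => T s / P * Real.log (T s / P)) ν :=
    integrable_add_const_iff.mp hmap.1
  refine ⟨hTlog, ?_⟩
  simpa [integral_add hTlog (integrable_const 1), integral_add hSlog (integrable_const 1)]
    using hmap.2

theorem isEntropyDensity (hφ : IsDiagonalized μ W R φ S)
    (hW : Tendsto W atTop atTop) (hR : HasNegligibleTails W R A) (hS0 : 0 ≤ᵐ[μ] S) (hP : 0 < P)
    (hSP : ∫ s, S s ∂μ = P) (hθ : IsNormalizedSystem ν W θ)
    (hT : TendstoInMeasure ν (fun M => transitionIntegral μ θ φ (W M) S) atTop T) :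
    IsEntropyDensity ν fun s => T s / P := by
  obtain ⟨hTi, hTS⟩ := hφ.integrable_and_integral_eq hW hR hS0 hθ hT
  have hT0 : 0 ≤ᵐ[ν] T := ae_nonneg_of_tendstoInMeasure
    (fun M => .of_forall (transitionIntegral_nonneg hS0 θ φ (W M))) hT
  exact
    { nonneg := hT0.mono fun s hs => div_nonneg hs hP.le
      integrable := hTi.div_const P
      integral_eq_one := by rw [integral_div, hTS, hSP, div_self hP.ne']
      integrable_mul_log :=
        (hφ.integrable_and_integral_div_mul_log_div_le hW hR hS0 hP hθ hT).1 }

end IsDiagonalized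

end Entropy

section SecondOrder

variable {ι α Ω : Type*} [MeasurableSpace α] [MeasurableSpace Ω] {μ : Measure α} {Pr : Measure Ω}
  {W : ℕ → Finset ι} {A P : ℝ} {x : ι → Ω → ℂ} {φ : ι → α → ℂ} {S : α → ℝ}

/-- The correlation matrix `E[x(k) x*(l)]` of a second-order process. The autocorrelation
`r(l, k - l)` is its entry at `(k, l)`. -/
noncomputable def correlation (Pr : Measure Ω) (x : ι → Ω → ℂ) (k l : ι) : ℂ :=
  ∫ ω, x k ω * star (x l ω) ∂Pr

/-- The expected periodogram `(1 / N) E|∑ₙ x(n) θ*(n, s)|²` over the indices `F`, where `N` is the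
size of `F`; its limit is the power spectrum of `x` in `θ`. -/
noncomputable def periodogram {β : Type*} (Pr : Measure Ω) (x : ι → Ω → ℂ) (θ : ι → β → ℂ)
    (F : Finset ι) (s : β) : ℝ :=
  (∫ ω, ‖∑ n ∈ F, x n ω * star (θ n s)‖ ^ 2 ∂Pr) / #F

theorem re_correlation_self (k : ι) : (correlation Pr x k k).re = ∫ ω, ‖x k ω‖ ^ 2 ∂Pr := by
  simp only [correlation, ← ofReal_norm_sq_eq_mul_star]
  rw [integral_complex_ofReal, Complex.ofReal_re]

namespace IsDiagonalized

variable [DecidableEq ι]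

theorem integral_mul_diagAverage {R : ι → ι → ℂ} (hφ : IsDiagonalized μ W R φ S)
    (hW : Tendsto W atTop atTop) (hR : HasNegligibleTails W R A) (F : Finset ι) :
    ∫ s, S s * diagAverage φ F s ∂μ = 𝔼 k ∈ F, (R k k).re := by
  have re_mul (k : ι) (s : α) :
      S s * ‖φ k s‖ ^ 2 = ((S s : ℂ) * (φ k s * star (φ k s))).re := by
    rw [← ofReal_norm_sq_eq_mul_star, ← Complex.ofReal_mul, Complex.ofReal_re]
  simp only [diagAverage, Finset.mul_expect, re_mul]
  refine (integral_expect fun k _ => (hφ.integrable_mul_mul_star hW hR k k).re).trans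
    (Finset.expect_congr rfl fun k _ => ?_)
  rw [← hφ.integral_mul_mul_star hW hR k k]
  exact integral_re (hφ.integrable_mul_mul_star hW hR k k)

theorem periodogram_eq_transitionIntegral {β : Type*} (hx : ∀ n, MemLp (x n) 2 Pr)
    (hφ : IsDiagonalized μ W (correlation Pr x) φ S) (hW : Tendsto W atTop atTop)
    (hR : HasNegligibleTails W (correlation Pr x) A) (θ : ι → β → ℂ) (F : Finset ι) :
    periodogram Pr x θ F = transitionIntegral μ θ φ F S := by
  funext s
  rw [← Complex.ofReal_inj, hφ.ofReal_transitionIntegral hW hR, periodogram, Complex.ofReal_div,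
    Complex.ofReal_natCast]
  simp only [mul_comm (x _ _), ofReal_integral_norm_sq_sum hx, star_star, correlation]

theorem integral_eq_of_tendsto [Nonempty ι] [IsProbabilityMeasure μ] {R : ι → ι → ℂ}
    (hφ : IsDiagonalized μ W R φ S) (hW : Tendsto W atTop atTop) (hR : HasNegligibleTails W R A)
    (hP : Tendsto (fun M => 𝔼 k ∈ W M, (R k k).re) atTop (𝓝 P)) : ∫ s, S s ∂μ = P := by
  have hlim := hφ.tendsto_integral_mul_diagAverage hW hR (hφ.aestronglyMeasurable hW hR)
    (isSubordinate_sq S)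
  simp only [hφ.integral_mul_diagAverage hW hR] at hlim
  exact tendsto_nhds_unique hlim hP

end IsDiagonalized

end SecondOrder

section UnitInterval

instance : IsProbabilityMeasure specMeasure := ⟨by simp [specMeasure]⟩

theorem one_div_mul_sum_window (M : ℕ) (f : ℤ → ℝ) :
    (1 / (2 * M : ℝ)) * ∑ n ∈ window M, f n = 𝔼 n ∈ window M, f n := by
  rw [Finset.expect_eq_sum_div_card, card_window, Nat.cast_mul, Nat.cast_two, one_div_mul_eq_div]

theorem IsUnitaryBasis.isNormalizedSystem {θ : ℤ → ℝ → ℂ} (hθ : IsUnitaryBasis θ) :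
    IsNormalizedSystem specMeasure window θ where
  memLp := hθ.memLp
  integral_mul_star := hθ.orthonormal
  normalized := by
    have h := hθ.normalized
    simp only [one_div_mul_sum_window] at h
    exact h

theorem IsEntropyDensity.entropyDefined {P : ℝ} {S : ℝ → ℝ}
    (h : IsEntropyDensity specMeasure fun s => S s / P) : EntropyDefined P S :=
  ⟨h.nonneg, h.integrable, h.integral_eq_one, h.integrable_mul_log⟩

variable {Ω : Type*} [MeasurableSpace Ω] {Pr : Measure Ω} {x : ℤ → Ω → ℂ}

theorem autocorr_sub (k l : ℤ) : autocorr Pr x l (k - l) = correlation Pr x k l := by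
  rw [autocorr, correlation, add_sub_cancel]

theorem SquareSummableAutocorr.exists_hasNegligibleTails (hr : SquareSummableAutocorr Pr x) :
    ∃ A, HasNegligibleTails window (correlation Pr x) A := by
  obtain ⟨a, ha, hra⟩ := hr
  refine ⟨_, hasNegligibleTails_window ha fun k l => ?_⟩
  rw [← autocorr_sub]
  exact pow_le_pow_left₀ (norm_nonneg _) (hra l (k - l)) 2

theorem HasAveragePower.tendsto_expect {P : ℝ} (hP : HasAveragePower Pr x P) :
    Tendsto (fun M => 𝔼 n ∈ window M, ∫ ω, ‖x n ω‖ ^ 2 ∂Pr) atTop (𝓝 P) := by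
  simpa only [HasAveragePower, one_div_mul_sum_window] using hP

theorem hasSpectrum_iff_tendstoInMeasure_periodogram {θ : ℤ → ℝ → ℂ} {S : ℝ → ℝ} :
    HasSpectrum Pr x θ S ↔
      TendstoInMeasure specMeasure (fun M => periodogram Pr x θ (window M)) atTop S := by
  have h (M : ℕ) (s : ℝ) : (1 / (2 * M : ℝ)) *
      ∫ ω, ‖∑ n ∈ window M, x n ω * star (θ n s)‖ ^ 2 ∂Pr = periodogram Pr x θ (window M) s := by
    rw [periodogram, card_window, Nat.cast_mul, Nat.cast_two, one_div_mul_eq_div]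
  simp only [HasSpectrum, h]

theorem IsKLBasis.isDiagonalized {φ : ℤ → ℝ → ℂ} {S : ℝ → ℝ} (hφ : IsKLBasis Pr x φ S) :
    IsDiagonalized specMeasure window (correlation Pr x) φ S where
  toIsNormalizedSystem := hφ.unitary.isNormalizedSystem
  eigen k := by simpa only [autocorr_sub] using hφ.eigen k

end UnitInterval

end SpectralEntropy

open SpectralEntropy MeasureTheory Filter Topology in
open scoped BigOperators in
theorem proposition1_general {ι α Ω : Type*} [DecidableEq ι] [Nonempty ι] [MeasurableSpace α]
    [MeasurableSpace Ω] {μ : Measure α} [IsProbabilityMeasure μ] {Pr : Measure Ω}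
    {W : ℕ → Finset ι} (hW : Tendsto W atTop atTop)
    {x : ι → Ω → ℂ} (hx : ∀ n, MemLp (x n) 2 Pr)
    {A : ℝ} (hR : HasNegligibleTails W (correlation Pr x) A)
    {P : ℝ} (hP : Tendsto (fun M => 𝔼 n ∈ W M, ∫ ω, ‖x n ω‖ ^ 2 ∂Pr) atTop (𝓝 P)) (hP0 : 0 < P)
    {φ : ι → α → ℂ} {S : α → ℝ} (hφ : IsDiagonalized μ W (correlation Pr x) φ S) :
    TendstoInMeasure μ (fun M => periodogram Pr x φ (W M)) atTop S ∧
      IsEntropyDensity μ (fun s => S s / P) ∧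
        ∀ (θ : ι → α → ℂ) (T : α → ℝ), IsNormalizedSystem μ W θ →
          TendstoInMeasure μ (fun M => periodogram Pr x θ (W M)) atTop T →
            IsEntropyDensity μ (fun s => T s / P) ∧
              ∫ s, T s / P * Real.log (T s / P) ∂μ ≤ ∫ s, S s / P * Real.log (S s / P) ∂μ := by
  have hφS := hφ.tendstoInMeasure_transitionIntegral hW hR
  have hSP : ∫ s, S s ∂μ = P :=
    hφ.integral_eq_of_tendsto hW hR (by simpa only [re_correlation_self] using hP)
  have periodogram_nonneg (M : ℕ) : 0 ≤ᵐ[μ] periodogram Pr x φ (W M) :=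
    .of_forall fun s => div_nonneg (integral_nonneg fun ω => by positivity) (Nat.cast_nonneg _)
  simp only [hφ.periodogram_eq_transitionIntegral hx hW hR] at periodogram_nonneg ⊢
  have hS0 : 0 ≤ᵐ[μ] S := ae_nonneg_of_tendstoInMeasure periodogram_nonneg hφS
  exact ⟨hφS, hφ.isEntropyDensity hW hR hS0 hP0 hSP hφ.toIsNormalizedSystem hφS,
    fun θ T hθ hT => ⟨hφ.isEntropyDensity hW hR hS0 hP0 hSP hθ hT,
      (hφ.integrable_and_integral_div_mul_log_div_le hW hR hS0 hP0 hθ hT).2⟩⟩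

theorem proposition1 {Ω : Type*} [MeasurableSpace Ω] (Pr : MeasureTheory.Measure Ω)
    [MeasureTheory.IsProbabilityMeasure Pr]
    (x : ℤ → Ω → ℂ) (hx : ∀ n, MeasureTheory.MemLp (x n) 2 Pr)
    (hr : SpectralEntropy.SquareSummableAutocorr Pr x)
    (P : ℝ) (hP : SpectralEntropy.HasAveragePower Pr x P) (hP0 : 0 < P)
    (φ : ℤ → ℝ → ℂ) (S : ℝ → ℝ) (hφ : SpectralEntropy.IsKLBasis Pr x φ S) :
    SpectralEntropy.HasSpectrum Pr x φ S ∧ SpectralEntropy.EntropyDefined P S ∧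
      ∀ (θ : ℤ → ℝ → ℂ) (Sθ : ℝ → ℝ), SpectralEntropy.IsUnitaryBasis θ →
        SpectralEntropy.HasSpectrum Pr x θ Sθ →
          SpectralEntropy.EntropyDefined P Sθ ∧
            SpectralEntropy.repEntropy P S ≤ SpectralEntropy.repEntropy P Sθ := by
  obtain ⟨A, hR⟩ := hr.exists_hasNegligibleTails
  obtain ⟨hφS, hpS, hmin⟩ := proposition1_general SpectralEntropy.tendsto_window_atTop hx hR
    hP.tendsto_expect hP0 hφ.isDiagonalized
  exact ⟨SpectralEntropy.hasSpectrum_iff_tendstoInMeasure_periodogram.2 hφS, hpS.entropyDefined,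
    fun θ Sθ hθ hSθ => (hmin θ Sθ hθ.isNormalizedSystem
      (SpectralEntropy.hasSpectrum_iff_tendstoInMeasure_periodogram.1 hSθ)).imp
        (fun h => h.entropyDefined) neg_le_neg⟩
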